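/- Let $n,d\ge 1$ and let $G$ be a real symmetric $n\times n$ matrix with nonnegative entries and $\sum_{i,j}G_{i,j}=1$. Put $\pi_j:=\sum_i G_{i,j}$ and $A_{i,j}:=G_{i,j}/\pi_j$ (with $A_{i,j}:=0$ if $\pi_j=0$), and $$\varepsilon:=14\left(d^4\,\ln(d)\,\operatorname{tr}[A^2]\,\|\pi\|_2^2\right)^{1/8}+\|\pi\|_2^2,\qquad \|\pi\|_2^2=\sum_j\pi_j^2 .$$ For an operator $\rho$ on $(\mathbb C^d)^{\otimes n}$ let $\rho^{Q_iQ_j}$ be its marginal on the sites in $\{i,j\}$ (the partial trace over all other sites; for $i=j$ this is the one-site marginal), and let $\|X\|_1=\operatorname{tr}\sqrt{X^\dagger X}$. A state (positive semidefinite operator of trace one) $\sigma$ on $(\mathbb C^d)^{\otimes n}$ is called globally separable if $\sigma=\sum_z p_z\,\sigma_z^{1}\otimes\cdots\otimes\sigma_z^{n}$ for a finite probability distribution $(p_z)$ and states $\sigma_z^{k}$ on $\mathbb C^d$. (1) For every state $\rho$ on $(\mathbb C^d)^{\otimes n}$ there is a globally separable state $\sigma$ with $$\sum_{i,j}G_{i,j}\,\bigl\|\rho^{Q_iQ_j}-\sigma^{Q_iQ_j}\bigr\|_1\le\varepsilon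 .$$ (2) Let $H=\sum_{i,j}G_{i,j}H_{i,j}$, where each $H_{i,j}$ is a Hermitian operator on $(\mathbb C^d)^{\otimes n}$ that acts only on the sites $i,j$ (as the identity on all others) and has operator norm $\|H_{i,j}\|\le 1$. Then there are unit vectors $|\varphi_1\rangle,\dots,|\varphi_n\rangle\in\mathbb C^d$ such that $|\varphi\rangle=|\varphi_1\rangle\otimes\cdots\otimes|\varphi_n\rangle$ satisfies $$\langle\varphi|H|\varphi\rangle\le e_0(H)+\varepsilon,\qquad e_0(H):=\min\{\langle\psi|H|\psi\rangle:\langle\psi|\psi\rangle=1\}.$$ -/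

import Mathlib

open scoped ComplexOrder

noncomputable section

namespace ProductApprox

/-- Computational basis labels of the qudits (of local dimension `d`) located at the sites in `S`. -/
abbrev Config {n : ℕ} (d : ℕ) (S : Finset (Fin n)) : Type := {k : Fin n // k ∈ S} → Fin d

/-- Operators on `(ℂ^d)^{⊗ n}`, as matrices in the computational basis. -/
abbrev Op (n d : ℕ) : Type := Matrix (Fin n → Fin d) (Fin n → Fin d) ℂ

/-- Quantum states: positive semidefinite matrices of unit trace. -/
def IsDensity {ι : Type*} [Fintype ι] (ρ : Matrix ι ι ℂ) : Prop :=
  ρ.PosSemidef ∧ ρ.trace = 1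

/-- The trace norm `tr √(X† X)`: the square roots of the eigenvalues of `X† X` are summed. -/
def traceNorm {ι : Type*} [Fintype ι] [DecidableEq ι] (X : Matrix ι ι ℂ) : ℝ :=
  ∑ i, Real.sqrt ((Matrix.isHermitian_conjTranspose_mul_self X).eigenvalues i)

/-- The operator norm (largest singular value), for the Euclidean norm on vectors. -/
def opNorm {ι : Type*} [Fintype ι] [DecidableEq ι] (X : Matrix ι ι ℂ) : ℝ :=
  ‖Matrix.toEuclideanCLM (n := ι) (𝕜 := ℂ) X‖

/-- The basis label of all `n` sites that is `x` on `S` and `z` off `S`. -/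
def glue {n d : ℕ} (S : Finset (Fin n)) (x : Config d S) (z : {k : Fin n // k ∉ S} → Fin d) :
    Fin n → Fin d :=
  fun k => if h : k ∈ S then x ⟨k, h⟩ else z ⟨k, h⟩

/-- The marginal `ρ^{Q_S}`: the partial trace of `ρ` over all sites outside `S`. -/
def marginal {n d : ℕ} (S : Finset (Fin n)) (ρ : Op n d) :
    Matrix (Config d S) (Config d S) ℂ :=
  Matrix.of fun x y => ∑ z : {k : Fin n // k ∉ S} → Fin d, ρ (glue S x z) (glue S y z)

/-- The operator `h ⊗ I` on all `n` sites, for an operator `h` on the sites in `S`. -/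
def extend {n d : ℕ} (S : Finset (Fin n)) (h : Matrix (Config d S) (Config d S) ℂ) : Op n d :=
  Matrix.of fun x y =>
    if ∀ k, k ∉ S → x k = y k then h (fun k => x k.1) (fun k => y k.1) else 0

/-- `M` acts only on the sites in `S`. -/
def ActsOnlyOn {n d : ℕ} (S : Finset (Fin n)) (M : Op n d) : Prop :=
  ∃ h : Matrix (Config d S) (Config d S) ℂ, M = extend S h

/-- The tensor product `s 0 ⊗ ⋯ ⊗ s (n - 1)` of single-site operators. -/
def tensorOp {n d : ℕ} (s : Fin n → Matrix (Fin d) (Fin d) ℂ) : Op n d :=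
  Matrix.of fun x y => ∏ k, s k (x k) (y k)

/-- The tensor product `φ 0 ⊗ ⋯ ⊗ φ (n - 1)` of single-site vectors. -/
def tensorVec {n d : ℕ} (φ : Fin n → EuclideanSpace ℂ (Fin d)) : (Fin n → Fin d) → ℂ :=
  fun x => ∏ k, φ k (x k)

/-- The projector `|ψ⟩⟨ψ|`. -/
def proj {ι : Type*} (ψ : ι → ℂ) : Matrix ι ι ℂ := Matrix.vecMulVec ψ (star ψ)

/-- Globally separable states: finite convex combinations `∑ p_z σ_z` of product states. -/
def GloballySeparable {n d : ℕ} (σ : Op n d) : Prop :=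
  ∃ (m : ℕ) (p : Fin m → ℝ) (s : Fin m → Fin n → Matrix (Fin d) (Fin d) ℂ),
    (∀ z, 0 ≤ p z) ∧ ∑ z, p z = 1 ∧ (∀ z k, IsDensity (s z k)) ∧
      σ = ∑ z, (p z : ℂ) • tensorOp (s z)

/-- The ground-state energy `e₀(H) = min {⟨ψ|H|ψ⟩ : ⟨ψ|ψ⟩ = 1}` of a Hermitian `H`. -/
def groundEnergy {ι : Type*} [Fintype ι] (H : Matrix ι ι ℂ) : ℝ :=
  sInf {e : ℝ | ∃ ψ : ι → ℂ, star ψ ⬝ᵥ ψ = 1 ∧ e = (star ψ ⬝ᵥ H.mulVec ψ).re}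

/-- The vector `π_j = ∑ i, G i j`. -/
def stationary {n : ℕ} (G : Matrix (Fin n) (Fin n) ℝ) (j : Fin n) : ℝ := ∑ i, G i j

/-- The random walk matrix `A i j = G i j / π_j`; a column with `π_j = 0` (then also
`G i j = 0` for all `i`) is zero. -/
def walkMatrix {n : ℕ} (G : Matrix (Fin n) (Fin n) ℝ) : Matrix (Fin n) (Fin n) ℝ :=
  Matrix.of fun i j => G i j / stationary G j

/-- The error `14 (d⁴ ln d tr[A²] ‖π‖₂²)^{1/8} + ‖π‖₂²`. -/
def errorBound {n : ℕ} (d : ℕ) (G : Matrix (Fin n) (Fin n) ℝ) : ℝ :=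
  14 * ((d : ℝ) ^ 4 * Real.log d * (walkMatrix G * walkMatrix G).trace *
      ∑ j, stationary G j ^ 2) ^ (1 / 8 : ℝ) + ∑ j, stationary G j ^ 2

end ProductApprox

end

/-! Fix an informationally complete measurement on `ℂ^d`. Measuring the sites in a set `C` and
replacing every other site by its state conditioned on the outcomes turns `ρ` into a mixture of
product states. Outside `C`, its two-site marginals differ from those of `ρ` only by the
covariances that remain after conditioning, and the covariance of the outcomes at `i` and `j` is at
most the amount by which also measuring `j` raises the mean square of the outcome density at `i`.
These mean squares are bounded, so for a suitable `C` of small `π`-weight the gains are small on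
average over `π ⊗ π`. Since `G i j ^ 2 = A i j * A j i * π i * π j`, the Cauchy–Schwarz inequality
passes from this average to the one over `G`, at the cost of `tr[A²]`.

For the product vector, approximate a ground state by a separable state; some product vector in its
decomposition has at most its energy. -/

noncomputable section

namespace ProductApprox

open Matrix Finset
open scoped BigOperators

section TraceNorm

theorem proj_posSemidef {ι : Type*} [Finite ι] (v : ι → ℂ) : (proj v).PosSemidef :=
  posSemidef_vecMulVec_self_star v

variable {ι : Type*} [Fintype ι]

theorem trace_mul_proj (A : Matrix ι ι ℂ) (v : ι → ℂ) :
    (A * proj v).trace = star v ⬝ᵥ A *ᵥ v := by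
  rw [proj, mul_vecMulVec, trace_vecMulVec, dotProduct_comm]

theorem isDensity_proj {v : ι → ℂ} (hv : star v ⬝ᵥ v = 1) : IsDensity (proj v) :=
  ⟨proj_posSemidef v, by rw [proj, trace_vecMulVec, dotProduct_comm, hv]⟩

open scoped MatrixOrder Matrix.Norms.L2Operator in
theorem exists_eq_conjTranspose_mul_self {A : Matrix ι ι ℂ} (hA : A.PosSemidef) :
    ∃ B : Matrix ι ι ℂ, A = Bᴴ * B := by
  classical
  exact CStarAlgebra.nonneg_iff_eq_star_mul_self.mp hA.nonneg

theorem trace_mul_nonneg {A B : Matrix ι ι ℂ} (hA : A.PosSemidef) (hB : B.PosSemidef) :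
    0 ≤ (A * B).trace := by
  obtain ⟨D, rfl⟩ := exists_eq_conjTranspose_mul_self hB
  rw [← mul_assoc, trace_mul_comm, ← mul_assoc]
  exact (hA.mul_mul_conjTranspose_same D).trace_nonneg

variable [DecidableEq ι]

theorem eq_sum_eigenvalues_smul_proj {X : Matrix ι ι ℂ} (hX : X.IsHermitian) :
    X = ∑ i, (hX.eigenvalues i : ℂ) • proj (hX.eigenvectorBasis i).ofLp := by
  conv_lhs => rw [hX.spectral_theorem, Unitary.conjStarAlgAut_apply]
  ext a b
  simp only [mul_apply, diagonal_apply, Matrix.sum_apply, Matrix.smul_apply, proj, vecMulVec_apply]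
  refine sum_congr rfl fun i _ => ?_
  simp only [IsHermitian.eigenvectorUnitary_apply, Function.comp_apply, mul_ite, mul_zero,
    sum_ite_eq', mem_univ, ↓reduceIte, star_apply, Pi.star_apply, smul_eq_mul,
    Complex.coe_algebraMap]
  ring

theorem sum_proj_eigenvectorBasis {X : Matrix ι ι ℂ} (hX : X.IsHermitian) :
    ∑ i, proj (hX.eigenvectorBasis i).ofLp = 1 := by
  rw [← Unitary.coe_mul_star_self hX.eigenvectorUnitary]
  ext a b
  simp [mul_apply, Matrix.sum_apply, proj, vecMulVec_apply, Matrix.star_apply]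

theorem sum_dotProduct_mulVec_eigenvectorBasis {X : Matrix ι ι ℂ} (hX : X.IsHermitian)
    (τ : Matrix ι ι ℂ) :
    ∑ i, star (hX.eigenvectorBasis i).ofLp ⬝ᵥ τ *ᵥ (hX.eigenvectorBasis i).ofLp = τ.trace := by
  simp only [← trace_mul_proj]
  rw [← trace_sum, ← mul_sum, sum_proj_eigenvectorBasis, mul_one]

theorem traceNorm_eq_sum_abs_eigenvalues {X : Matrix ι ι ℂ} (hX : X.IsHermitian) :
    traceNorm X = ∑ i, |hX.eigenvalues i| := by
  have hroots : (Xᴴ * X).charpoly.roots =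
      Multiset.map (fun i => ((hX.eigenvalues i ^ 2 : ℝ) : ℂ)) univ.val := by
    have hsq : Xᴴ * X = cfc (fun x : ℝ => x ^ 2) X := by
      rw [hX.eq, cfc_pow_id (R := ℝ) X 2 hX.isSelfAdjoint, pow_two]
    rw [hsq, hX.charpoly_cfc_eq, Polynomial.roots_prod _ _ (prod_ne_zero_iff.2
      fun i _ => Polynomial.X_sub_C_ne_zero _)]
    simp only [Polynomial.roots_X_sub_C, Multiset.bind_singleton]
    rfl
  have heigen := (isHermitian_conjTranspose_mul_self X).roots_charpoly_eq_eigenvalues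
  rw [hroots] at heigen
  have hsum := congrArg (fun s : Multiset ℂ => (s.map fun c => Real.sqrt c.re).sum) heigen
  simp only [Multiset.map_map, Function.comp_def, Complex.ofReal_re, Real.sqrt_sq_eq_abs] at hsum
  exact hsum.symm

theorem traceNorm_nonneg (X : Matrix ι ι ℂ) : 0 ≤ traceNorm X :=
  sum_nonneg fun _ _ => Real.sqrt_nonneg _

@[simp]
theorem traceNorm_zero : traceNorm (0 : Matrix ι ι ℂ) = 0 := by
  have h := (isHermitian_zero (n := ι) (α := ℂ)).eigenvalues_eq_zero_iff.2 rfl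
  simp [traceNorm_eq_sum_abs_eigenvalues isHermitian_zero, h]

theorem sum_eigenvalues_conjTranspose_mul_self (X : Matrix ι ι ℂ) :
    ∑ i, (isHermitian_conjTranspose_mul_self X).eigenvalues i = ∑ a, ∑ b, ‖X a b‖ ^ 2 := by
  have htrace : (Xᴴ * X).trace = ((∑ a, ∑ b, ‖X a b‖ ^ 2 : ℝ) : ℂ) := by
    rw [sum_comm]
    simp only [trace, diag_apply, mul_apply, conjTranspose_apply]
    push_cast
    exact sum_congr rfl fun i _ => sum_congr rfl fun j _ => Complex.conj_mul' _
  have h := (isHermitian_conjTranspose_mul_self X).trace_eq_sum_eigenvalues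
  rw [htrace] at h
  rw [← RCLike.ofReal_sum] at h
  exact (Complex.ofReal_injective h).symm

theorem traceNorm_sq_le (X : Matrix ι ι ℂ) :
    traceNorm X ^ 2 ≤ Fintype.card ι * ∑ a, ∑ b, ‖X a b‖ ^ 2 := by
  have hpos := (posSemidef_conjTranspose_mul_self X).eigenvalues_nonneg
  calc traceNorm X ^ 2
      ≤ Fintype.card ι * ∑ i, √((isHermitian_conjTranspose_mul_self X).eigenvalues i) ^ 2 := by
        exact sq_sum_le_card_mul_sum_sq
    _ = _ := by simp only [Real.sq_sqrt (hpos _), sum_eigenvalues_conjTranspose_mul_self]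

theorem traceNorm_sub_le_two {ρ σ : Matrix ι ι ℂ} (hρ : IsDensity ρ) (hσ : IsDensity σ) :
    traceNorm (ρ - σ) ≤ 2 := by
  have hX : (ρ - σ).IsHermitian := hρ.1.isHermitian.sub hσ.1.isHermitian
  let energy (τ : Matrix ι ι ℂ) (i : ι) : ℝ :=
    (star (hX.eigenvectorBasis i).ofLp ⬝ᵥ τ *ᵥ (hX.eigenvectorBasis i).ofLp).re
  have sum_energy {τ : Matrix ι ι ℂ} (hτ : IsDensity τ) : ∑ i, energy τ i = 1 := by
    simp only [energy, ← Complex.re_sum, sum_dotProduct_mulVec_eigenvectorBasis, hτ.2,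
      Complex.one_re]
  have eigenvalues_eq (i : ι) : hX.eigenvalues i = energy ρ i - energy σ i := by
    simp only [hX.eigenvalues_eq i, energy, sub_mulVec, dotProduct_sub, map_sub,
      RCLike.re_to_complex]
  rw [traceNorm_eq_sum_abs_eigenvalues hX]
  calc ∑ i, |hX.eigenvalues i|
      ≤ ∑ i, (energy ρ i + energy σ i) := sum_le_sum fun i _ => by
        have hρi : 0 ≤ energy ρ i := hρ.1.re_dotProduct_nonneg _
        have hσi : 0 ≤ energy σ i := hσ.1.re_dotProduct_nonneg _
        rw [eigenvalues_eq, abs_le]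
        constructor <;> linarith
    _ = 2 := by rw [sum_add_distrib, sum_energy hρ, sum_energy hσ, one_add_one_eq_two]

theorem abs_re_dotProduct_mulVec_le_opNorm (A : Matrix ι ι ℂ) {v : EuclideanSpace ℂ ι}
    (hv : ‖v‖ = 1) : |(star v.ofLp ⬝ᵥ A *ᵥ v.ofLp).re| ≤ opNorm A := by
  have hinner : star v.ofLp ⬝ᵥ A *ᵥ v.ofLp =
      inner ℂ v (toEuclideanCLM (n := ι) (𝕜 := ℂ) A v) := by
    rw [EuclideanSpace.inner_eq_star_dotProduct, dotProduct_comm]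
    rfl
  calc |(star v.ofLp ⬝ᵥ A *ᵥ v.ofLp).re|
      ≤ ‖v‖ * ‖toEuclideanCLM (n := ι) (𝕜 := ℂ) A v‖ := by
        rw [hinner]
        exact (Complex.abs_re_le_norm _).trans (norm_inner_le_norm _ _)
    _ ≤ opNorm A := by
        rw [hv, one_mul]
        exact (ContinuousLinearMap.le_opNorm _ _).trans_eq (by rw [hv, mul_one, opNorm])

theorem abs_re_trace_mul_le {A X : Matrix ι ι ℂ} (hX : X.IsHermitian) {K : ℝ}
    (hA : ∀ v : EuclideanSpace ℂ ι, ‖v‖ = 1 → |(star v.ofLp ⬝ᵥ A *ᵥ v.ofLp).re| ≤ K) :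
    |(A * X).trace.re| ≤ K * traceNorm X := by
  have htrace : (A * X).trace.re = ∑ i, hX.eigenvalues i *
      (star (hX.eigenvectorBasis i).ofLp ⬝ᵥ A *ᵥ (hX.eigenvectorBasis i).ofLp).re := by
    conv_lhs => rw [eq_sum_eigenvalues_smul_proj hX]
    simp only [mul_sum, trace_sum, Complex.re_sum, Matrix.mul_smul, trace_smul, smul_eq_mul,
      Complex.re_ofReal_mul, trace_mul_proj]
  rw [htrace, traceNorm_eq_sum_abs_eigenvalues hX, mul_sum]
  refine (abs_sum_le_sum_abs _ _).trans (sum_le_sum fun i _ => ?_)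
  rw [abs_mul, mul_comm]
  exact mul_le_mul_of_nonneg_right (hA _ (hX.eigenvectorBasis.orthonormal.1 i)) (abs_nonneg _)

end TraceNorm

section Tensor

variable {n d : ℕ}

theorem tensorOp_mul (a b : Fin n → Matrix (Fin d) (Fin d) ℂ) :
    tensorOp a * tensorOp b = tensorOp fun k => a k * b k := by
  ext x y
  simp only [mul_apply, tensorOp, of_apply, prod_univ_sum, Fintype.piFinset_univ, prod_mul_distrib]

theorem conjTranspose_tensorOp (a : Fin n → Matrix (Fin d) (Fin d) ℂ) :
    (tensorOp a)ᴴ = tensorOp fun k => (a k)ᴴ := by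
  ext x y
  simp [tensorOp, conjTranspose_apply]

theorem trace_tensorOp (a : Fin n → Matrix (Fin d) (Fin d) ℂ) :
    (tensorOp a).trace = ∏ k, (a k).trace := by
  simp only [trace, diag_apply, tensorOp, of_apply, prod_univ_sum, Fintype.piFinset_univ]

theorem tensorOp_one : tensorOp (1 : Fin n → Matrix (Fin d) (Fin d) ℂ) = 1 := by
  ext x y
  simp only [tensorOp, of_apply, Pi.one_apply, one_apply, Fintype.prod_ite_zero, prod_const_one,
    funext_iff]

theorem tensorOp_posSemidef {a : Fin n → Matrix (Fin d) (Fin d) ℂ} (ha : ∀ k, (a k).PosSemidef) :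
    (tensorOp a).PosSemidef := by
  choose B hB using fun k => exists_eq_conjTranspose_mul_self (ha k)
  rw [funext hB, ← tensorOp_mul, ← conjTranspose_tensorOp]
  exact posSemidef_conjTranspose_mul_self _

theorem tensorOp_isDensity {a : Fin n → Matrix (Fin d) (Fin d) ℂ} (ha : ∀ k, IsDensity (a k)) :
    IsDensity (tensorOp a) :=
  ⟨tensorOp_posSemidef fun k => (ha k).1, by simp [trace_tensorOp, (ha _).2]⟩

theorem tensorOp_proj (φ : Fin n → EuclideanSpace ℂ (Fin d)) :
    tensorOp (fun k => proj (φ k).ofLp) = proj (tensorVec φ) := by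
  ext x y
  simp [tensorOp, proj, vecMulVec_apply, tensorVec, prod_mul_distrib]

theorem tensorOp_update_apply (a : Fin n → Matrix (Fin d) (Fin d) ℂ) (i : Fin n)
    (B : Matrix (Fin d) (Fin d) ℂ) (x y : Fin n → Fin d) :
    tensorOp (Function.update a i B) x y = B (x i) (y i) * ∏ k ∈ univ.erase i, a k (x k) (y k) := by
  rw [tensorOp, of_apply, ← mul_prod_erase _ _ (mem_univ i), Function.update_self]
  congr 1
  refine prod_congr rfl fun k hk => ?_
  rw [Function.update_of_ne (ne_of_mem_erase hk)]

/-- The expectation `tr[ρ (a 0 ⊗ ⋯ ⊗ a (n - 1))]` of a product observable in `ρ`, as a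
multilinear map of the factors. -/
def pairing (ρ : Op n d) : MultilinearMap ℂ (fun _ : Fin n => Matrix (Fin d) (Fin d) ℂ) ℂ :=
  MultilinearMap.mk' (fun a => (ρ * tensorOp a).trace)
    (fun a i B B' => by
      rw [← trace_add, ← mul_add]
      congr 2
      ext x y
      simp only [tensorOp_update_apply, Matrix.add_apply, add_mul])
    (fun a i c B => by
      rw [← trace_smul, ← Matrix.mul_smul]
      congr 2
      ext x y
      simp only [tensorOp_update_apply, Matrix.smul_apply, smul_mul_assoc])

theorem pairing_apply (ρ : Op n d) (a : Fin n → Matrix (Fin d) (Fin d) ℂ) :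
    pairing ρ a = (ρ * tensorOp a).trace := rfl

theorem pairing_one (ρ : Op n d) : pairing ρ 1 = ρ.trace := by
  rw [pairing_apply, tensorOp_one, mul_one]

theorem pairing_tensorOp (s a : Fin n → Matrix (Fin d) (Fin d) ℂ) :
    pairing (tensorOp s) a = ∏ k, (s k * a k).trace := by
  rw [pairing_apply, tensorOp_mul, trace_tensorOp]

theorem pairing_sub (ρ σ : Op n d) (a : Fin n → Matrix (Fin d) (Fin d) ℂ) :
    pairing (ρ - σ) a = pairing ρ a - pairing σ a := by
  simp only [pairing_apply, sub_mul, trace_sub]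

theorem pairing_nonneg {ρ : Op n d} (hρ : ρ.PosSemidef) {a : Fin n → Matrix (Fin d) (Fin d) ℂ}
    (ha : ∀ k, (a k).PosSemidef) : 0 ≤ pairing ρ a :=
  trace_mul_nonneg hρ (tensorOp_posSemidef ha)

theorem star_pairing {ρ : Op n d} (hρ : ρ.IsHermitian) (a : Fin n → Matrix (Fin d) (Fin d) ℂ) :
    star (pairing ρ a) = pairing ρ fun k => (a k)ᴴ := by
  rw [pairing_apply, ← trace_conjTranspose, conjTranspose_mul, conjTranspose_tensorOp, hρ.eq,
    trace_mul_comm, pairing_apply]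

/-- The operator at site `i` that remains of `ρ` when the observables `a` are evaluated at all
other sites, whatever the value of `a i`. -/
def reduced (ρ : Op n d) (a : Fin n → Matrix (Fin d) (Fin d) ℂ) (i : Fin n) :
    Matrix (Fin d) (Fin d) ℂ :=
  Matrix.of fun u v => pairing ρ (Function.update a i (single v u 1))

theorem trace_reduced_mul (ρ : Op n d) (a : Fin n → Matrix (Fin d) (Fin d) ℂ) (i : Fin n)
    (B : Matrix (Fin d) (Fin d) ℂ) :
    (reduced ρ a i * B).trace = pairing ρ (Function.update a i B) := by
  have h : (pairing ρ).toLinearMap a i =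
      traceLinearMap (Fin d) ℂ ℂ ∘ₗ LinearMap.mulLeft ℂ (reduced ρ a i) := by
    refine Matrix.ext_linearMap _ fun u v => LinearMap.ext_ring ?_
    simp [trace_mul_single, reduced]
  exact (LinearMap.congr_fun h B).symm

theorem posSemidef_update {a : Fin n → Matrix (Fin d) (Fin d) ℂ} (ha : ∀ k, (a k).PosSemidef)
    (i : Fin n) {B : Matrix (Fin d) (Fin d) ℂ} (hB : B.PosSemidef) (k : Fin n) :
    (Function.update a i B k).PosSemidef := by
  obtain rfl | hk := eq_or_ne k i
  · rwa [Function.update_self]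
  · rw [Function.update_of_ne hk]
    exact ha k

theorem reduced_isHermitian {ρ : Op n d} (hρ : ρ.IsHermitian)
    {a : Fin n → Matrix (Fin d) (Fin d) ℂ} (ha : ∀ k, (a k).IsHermitian) (i : Fin n) :
    (reduced ρ a i).IsHermitian := by
  ext u v
  rw [conjTranspose_apply, reduced, of_apply, of_apply, star_pairing hρ]
  congr 1
  funext k
  obtain rfl | hk := eq_or_ne k i
  · simp
  · simp [hk, (ha k).eq]

theorem reduced_posSemidef {ρ : Op n d} (hρ : ρ.PosSemidef)
    {a : Fin n → Matrix (Fin d) (Fin d) ℂ} (ha : ∀ k, (a k).PosSemidef) (i : Fin n) :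
    (reduced ρ a i).PosSemidef := by
  refine .of_dotProduct_mulVec_nonneg
    (reduced_isHermitian hρ.isHermitian (fun k => (ha k).isHermitian) i) fun w => ?_
  rw [← trace_mul_proj, trace_reduced_mul]
  exact pairing_nonneg hρ (posSemidef_update ha i (proj_posSemidef w))

/-- The expectation in `ρ` of a product observable as a bilinear map of its factors at the two
sites `i ≠ j`, the other factors being those of `a`. -/
def pairFunctional (ρ : Op n d) (a : Fin n → Matrix (Fin d) (Fin d) ℂ) {i j : Fin n}
    (hij : i ≠ j) : Matrix (Fin d) (Fin d) ℂ →ₗ[ℂ] Matrix (Fin d) (Fin d) ℂ →ₗ[ℂ] ℂ :=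
  LinearMap.mk₂ ℂ (fun B B' => pairing ρ (Function.update (Function.update a i B) j B'))
    (fun _ _ _ => by simp only [Function.update_comm hij, MultilinearMap.map_update_add])
    (fun _ _ _ => by simp only [Function.update_comm hij, MultilinearMap.map_update_smul])
    (fun _ _ _ => by simp only [MultilinearMap.map_update_add])
    (fun _ _ _ => by simp only [MultilinearMap.map_update_smul])

theorem pairFunctional_apply (ρ : Op n d) (a : Fin n → Matrix (Fin d) (Fin d) ℂ) {i j : Fin n}
    (hij : i ≠ j) (B B' : Matrix (Fin d) (Fin d) ℂ) :
    pairFunctional ρ a hij B B' = pairing ρ (Function.update (Function.update a i B) j B') := rfl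

end Tensor

section Marginal

variable {n d : ℕ}

theorem sum_eq_sum_glue {M : Type*} [AddCommMonoid M] (S : Finset (Fin n))
    (f : (Fin n → Fin d) → M) : ∑ x, f x = ∑ u, ∑ z, f (glue S u z) := by
  rw [← Fintype.sum_prod_type' (f := fun u z => f (glue S u z))]
  exact (Equiv.sum_comp (Equiv.piEquivPiSubtypeProd (fun k => k ∈ S) fun _ => Fin d).symm f).symm

theorem extend_glue (S : Finset (Fin n)) (h : Matrix (Config d S) (Config d S) ℂ)
    (u v : Config d S) (z w : {k : Fin n // k ∉ S} → Fin d) :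
    extend S h (glue S u z) (glue S v w) = if z = w then h u v else 0 := by
  have hoff : (∀ k, k ∉ S → glue S u z k = glue S v w k) ↔ z = w := by
    simp +contextual [glue, funext_iff]
  simp only [extend, of_apply, hoff]
  simp [glue]

theorem trace_mul_extend (S : Finset (Fin n)) (ρ : Op n d)
    (h : Matrix (Config d S) (Config d S) ℂ) :
    (ρ * extend S h).trace = (marginal S ρ * h).trace := by
  simp only [trace, diag_apply, mul_apply, marginal, of_apply]
  rw [sum_eq_sum_glue S]
  simp_rw [sum_eq_sum_glue S (M := ℂ) (d := d), extend_glue]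
  refine sum_congr rfl fun u _ => ?_
  rw [sum_comm]
  refine sum_congr rfl fun v _ => ?_
  simp [sum_mul]

theorem extend_single (S : Finset (Fin n)) (u v : Config d S) :
    extend S (single u v 1) =
      tensorOp fun k => if h : k ∈ S then single (u ⟨k, h⟩) (v ⟨k, h⟩) 1 else 1 := by
  ext x y
  simp only [extend, tensorOp, of_apply, single_apply]
  rw [← Fintype.prod_subtype_mul_prod_subtype (fun k => k ∈ S)]
  have hin (k : {k // k ∈ S}) : (if h : k.1 ∈ S then single (u ⟨k.1, h⟩) (v ⟨k.1, h⟩) (1 : ℂ)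
      else 1) (x k.1) (y k.1) = if u k = x k.1 ∧ v k = y k.1 then 1 else 0 := by
    simp [single_apply]
  have hout (k : {k // k ∉ S}) : (if h : k.1 ∈ S then single (u ⟨k.1, h⟩) (v ⟨k.1, h⟩) (1 : ℂ)
      else 1) (x k.1) (y k.1) = if x k.1 = y k.1 then 1 else 0 := by
    simp [one_apply, k.2]
  simp only [hin, hout, Fintype.prod_ite_zero, prod_const_one, funext_iff, forall_and,
    Subtype.forall]
  split_ifs <;> simp_all

theorem marginal_apply (S : Finset (Fin n)) (ρ : Op n d) (u v : Config d S) :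
    marginal S ρ u v =
      pairing ρ fun k => if h : k ∈ S then single (v ⟨k, h⟩) (u ⟨k, h⟩) 1 else 1 := by
  rw [pairing_apply, ← extend_single, trace_mul_extend]
  simp [trace_mul_single]

theorem marginal_sub (S : Finset (Fin n)) (ρ σ : Op n d) :
    marginal S (ρ - σ) = marginal S ρ - marginal S σ := by
  ext u v
  simp only [marginal_apply, pairing_sub, Matrix.sub_apply]

theorem trace_marginal (S : Finset (Fin n)) (ρ : Op n d) : (marginal S ρ).trace = ρ.trace := by
  simp only [trace, diag_apply, marginal, of_apply, sum_eq_sum_glue S fun x => ρ x x]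

theorem marginal_isHermitian (S : Finset (Fin n)) {ρ : Op n d} (hρ : ρ.IsHermitian) :
    (marginal S ρ).IsHermitian := by
  ext u v
  simp only [marginal, conjTranspose_apply, of_apply, star_sum, hρ.apply]

theorem marginal_isDensity (S : Finset (Fin n)) {ρ : Op n d} (hρ : IsDensity ρ) :
    IsDensity (marginal S ρ) := by
  have hsum : marginal S ρ = ∑ z, ρ.submatrix (fun u => glue S u z) fun u => glue S u z := by
    ext u v
    simp [marginal, Matrix.sum_apply]
  refine ⟨?_, (trace_marginal S ρ).trans hρ.2⟩
  rw [hsum]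
  exact posSemidef_sum _ fun z _ => hρ.1.submatrix _

theorem marginal_singleton_eq_zero {i : Fin n} {τ : Op n d}
    (hτ : ∀ B, pairing τ (Function.update 1 i B) = 0) : marginal {i} τ = 0 := by
  ext u v
  rw [marginal_apply, Matrix.zero_apply, ← hτ (single (v ⟨i, by simp⟩) (u ⟨i, by simp⟩) 1)]
  congr 1
  funext k
  obtain rfl | hk := eq_or_ne k i
  · simp
  · simp [hk]

/-- The configurations of two distinct sites as pairs of labels. -/
def configPairEquiv {i j : Fin n} (hij : i ≠ j) :
    Config d ({i, j} : Finset (Fin n)) ≃ Fin d × Fin d where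
  toFun u := (u ⟨i, by simp⟩, u ⟨j, by simp⟩)
  invFun p k := if k.1 = i then p.1 else p.2
  left_inv u := by
    funext ⟨k, hk⟩
    obtain rfl | rfl : k = i ∨ k = j := by simpa using hk
    · simp
    · simp [hij.symm]
  right_inv p := by simp [hij.symm]

theorem marginal_pair_apply {i j : Fin n} (hij : i ≠ j) (ρ : Op n d)
    (u v : Config d ({i, j} : Finset (Fin n))) :
    marginal {i, j} ρ u v = pairFunctional ρ 1 hij
      (single (configPairEquiv hij v).1 (configPairEquiv hij u).1 1)
      (single (configPairEquiv hij v).2 (configPairEquiv hij u).2 1) := by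
  rw [marginal_apply, pairFunctional_apply]
  congr 1
  funext k
  obtain rfl | hj := eq_or_ne k j
  · simp [configPairEquiv]
  obtain rfl | hi := eq_or_ne k i
  · simp [configPairEquiv, hij]
  · simp [hi, hj]

theorem traceNorm_marginal_pair_sq_le {i j : Fin n} (hij : i ≠ j) (τ : Op n d) :
    traceNorm (marginal {i, j} τ) ^ 2 ≤ d ^ 2 *
      ∑ u, ∑ v, ∑ u', ∑ v', ‖pairFunctional τ 1 hij (single u v 1) (single u' v' 1)‖ ^ 2 := by
  refine (traceNorm_sq_le _).trans_eq ?_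
  have hcard : Fintype.card (Config d ({i, j} : Finset (Fin n))) = d ^ 2 := by
    rw [Fintype.card_congr (configPairEquiv hij), Fintype.card_prod, Fintype.card_fin, pow_two]
  rw [hcard, Nat.cast_pow]
  congr 1
  simp only [marginal_pair_apply hij]
  calc _ = ∑ p : Fin d × Fin d, ∑ q : Fin d × Fin d,
        ‖pairFunctional τ 1 hij (single q.1 p.1 1) (single q.2 p.2 1)‖ ^ 2 :=
      Fintype.sum_equiv (configPairEquiv hij) _ _ fun u =>
        Fintype.sum_equiv (configPairEquiv hij) _ _ fun v => rfl
    _ = _ := by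
      rw [sum_comm]
      simp only [Fintype.sum_prod_type]
      exact sum_congr rfl fun u _ => sum_comm

end Marginal

section Averages

theorem expect_update {ι Y M : Type*} [Fintype ι] [DecidableEq ι] [Fintype Y] [Nonempty Y]
    [AddCommMonoid M] [Module ℚ≥0 M] (i : ι) (f : (ι → Y) → M) :
    𝔼 x, f x = 𝔼 x, 𝔼 y, f (Function.update x i y) := by
  have hswap : 𝔼 q : (ι → Y) × Y, f (Function.update q.1 i q.2) = 𝔼 q : (ι → Y) × Y, f q.1 := by
    refine expect_nbij' (fun q => (Function.update q.1 i q.2, q.1 i))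
      (fun q => (Function.update q.1 i q.2, q.1 i)) ?_ ?_ ?_ ?_ ?_ <;> simp
  rw [← univ_product_univ, expect_product' univ univ fun x y => f (Function.update x i y),
    expect_product' univ univ fun x _ => f x] at hswap
  simpa using hswap.symm

theorem sum_norm_expect_sq_le {X E : Type*} [Fintype X] [Fintype E] {f : E → X → ℂ}
    {p W : X → ℝ} (hp : ∀ x, 0 ≤ p x) (hW : ∀ x, 0 ≤ W x)
    (h : ∀ x, ∑ e, ‖f e x‖ ^ 2 ≤ p x * W x) :
    ∑ e, ‖𝔼 x, f e x‖ ^ 2 ≤ (𝔼 x, p x) * 𝔼 x, W x := by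
  let v (x : X) : EuclideanSpace ℂ E := WithLp.toLp 2 fun e => f e x
  have hsum : ∑ e, ‖∑ x, f e x‖ ^ 2 ≤ (∑ x, p x) * ∑ x, W x := by
    calc ∑ e, ‖∑ x, f e x‖ ^ 2 = ‖∑ x, v x‖ ^ 2 := by
          simp [EuclideanSpace.norm_sq_eq, v]
      _ ≤ (∑ x, ‖v x‖) ^ 2 := by
          gcongr
          exact norm_sum_le _ _
      _ ≤ (∑ x, p x) * ∑ x, W x :=
          sum_sq_le_sum_mul_sum_of_sq_le_mul _ (fun x _ => hp x) (fun x _ => hW x) fun x _ => by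
            simpa only [EuclideanSpace.norm_sq_eq] using h x
  simp only [Fintype.expect_eq_sum_div_card, norm_div, div_pow, ← sum_div, Complex.norm_natCast,
    div_mul_div_comm, ← pow_two]
  gcongr

end Averages

/-- A measurement on `ℂ^d` with outcomes in `Y`, given by the densities of its effects relative to
the uniform distribution on `Y`: their average, not their sum, is the identity. All the effects
are at most `K`. -/
structure Measurement (d : ℕ) (Y : Type*) [Fintype Y] (K : ℝ) where
  effect : Y → Matrix (Fin d) (Fin d) ℂ
  effect_posSemidef : ∀ y, (effect y).PosSemidef
  expect_effect : 𝔼 y, effect y = 1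
  bound_sub_effect_posSemidef : ∀ y, ((K : ℂ) • 1 - effect y).PosSemidef

namespace Measurement

variable {n d : ℕ} {Y : Type*} [Fintype Y] {K κ : ℝ} (M : Measurement d Y K)

theorem expect_map_effect (L : Matrix (Fin d) (Fin d) ℂ →ₗ[ℂ] ℂ) :
    𝔼 y, L (M.effect y) = L 1 := by
  rw [← M.expect_effect, Finset.expect, Finset.expect, map_nnrat_smul L, map_sum]

theorem one_le_bound [NeZero d] (M : Measurement d Y K) : 1 ≤ K := by
  have hle (y : Y) : (M.effect y 0 0).re ≤ K := by
    have h := (Complex.le_def.1 ((M.bound_sub_effect_posSemidef y).diag_nonneg (i := 0))).1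
    simpa using h
  have hone : 𝔼 y, (M.effect y 0 0).re = 1 := by
    have h := M.expect_map_effect (entryLinearMap ℂ ℂ 0 0)
    simp only [entryLinearMap_apply, one_apply_eq] at h
    rw [Fintype.expect_eq_sum_div_card, ← Complex.re_sum, ← Complex.div_natCast_re,
      ← Fintype.expect_eq_sum_div_card, h, Complex.one_re]
  have : Nonempty Y := by
    by_contra hY
    rw [not_nonempty_iff] at hY
    simp at hone
  exact hone ▸ expect_le univ_nonempty fun y _ => hle y

/-- Informational completeness with constant `κ`: a linear functional is controlled by its values
on the effects. -/
structure IsFrame (M : Measurement d Y K) (κ : ℝ) : Prop where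
  nonneg : 0 ≤ κ
  sum_norm_sq_le : ∀ L : Matrix (Fin d) (Fin d) ℂ →ₗ[ℂ] ℂ,
    ∑ u, ∑ v, ‖L (single u v 1)‖ ^ 2 ≤ κ * 𝔼 y, ‖L (M.effect y)‖ ^ 2

variable {M} in
theorem IsFrame.sum_norm_sq_le₂ (hM : M.IsFrame κ)
    (L : Matrix (Fin d) (Fin d) ℂ →ₗ[ℂ] Matrix (Fin d) (Fin d) ℂ →ₗ[ℂ] ℂ) :
    ∑ u, ∑ v, ∑ u', ∑ v', ‖L (single u v 1) (single u' v' 1)‖ ^ 2 ≤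
      κ ^ 2 * 𝔼 y, 𝔼 y', ‖L (M.effect y) (M.effect y')‖ ^ 2 := by
  calc ∑ u, ∑ v, ∑ u', ∑ v', ‖L (single u v 1) (single u' v' 1)‖ ^ 2
      ≤ ∑ u, ∑ v, κ * 𝔼 y', ‖L (single u v 1) (M.effect y')‖ ^ 2 :=
        sum_le_sum fun u _ => sum_le_sum fun v _ => hM.sum_norm_sq_le (L (single u v 1))
    _ = κ * 𝔼 y', ∑ u, ∑ v, ‖L.flip (M.effect y') (single u v 1)‖ ^ 2 := by
        simp only [← mul_sum, expect_sum_comm, LinearMap.flip_apply]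
    _ ≤ κ * 𝔼 y', κ * 𝔼 y, ‖L.flip (M.effect y') (M.effect y)‖ ^ 2 :=
        mul_le_mul_of_nonneg_left
          (expect_le_expect fun y' _ => hM.sum_norm_sq_le (L.flip (M.effect y'))) hM.nonneg
    _ = κ ^ 2 * 𝔼 y, 𝔼 y', ‖L (M.effect y) (M.effect y')‖ ^ 2 := by
        rw [← mul_expect, ← mul_assoc, ← pow_two, expect_comm]
        simp only [LinearMap.flip_apply]

/-- The product observable `b` with the factors at the sites in `C` replaced by the effects of the
outcomes `x`. -/
def measured (C : Finset (Fin n)) (x : Fin n → Y) (b : Fin n → Matrix (Fin d) (Fin d) ℂ) :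
    Fin n → Matrix (Fin d) (Fin d) ℂ :=
  fun k => if k ∈ C then M.effect (x k) else b k

section Measured

variable (C : Finset (Fin n)) {i : Fin n} (x : Fin n → Y)
  (b : Fin n → Matrix (Fin d) (Fin d) ℂ)

theorem measured_one_posSemidef (k : Fin n) : (M.measured C x 1 k).PosSemidef := by
  unfold measured
  split_ifs
  exacts [M.effect_posSemidef _, PosSemidef.one]

theorem measured_insert (i : Fin n) :
    M.measured (insert i C) x b = Function.update (M.measured C x b) i (M.effect (x i)) := by
  funext k
  obtain rfl | hk := eq_or_ne k i
  · simp [measured]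
  · simp [measured, hk]

variable {C}

theorem measured_update_outcome (hi : i ∉ C) (y : Y) :
    M.measured C (Function.update x i y) b = M.measured C x b := by
  funext k
  unfold measured
  split_ifs with hk
  · rw [Function.update_of_ne (ne_of_mem_of_not_mem hk hi)]
  · rfl

theorem measured_update (hi : i ∉ C) (B : Matrix (Fin d) (Fin d) ℂ) :
    M.measured C x (Function.update b i B) = Function.update (M.measured C x b) i B := by
  funext k
  obtain rfl | hk := eq_or_ne k i
  · simp [measured, hi]
  · simp [measured, hk]

theorem update_measured_one (hi : i ∉ C) :
    Function.update (M.measured C x 1) i 1 = M.measured C x 1 := by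
  rw [← measured_update M x 1 hi]
  exact congrArg (M.measured C x) (Function.update_eq_self i 1)

theorem expect_pairing_measured_insert (ρ : Op n d) (hi : i ∉ C) :
    𝔼 y, pairing ρ (M.measured (insert i C) (Function.update x i y) b) =
      pairing ρ (Function.update (M.measured C x b) i 1) := by
  simp only [measured_insert, measured_update_outcome M x b hi, Function.update_self]
  exact M.expect_map_effect ((pairing ρ).toLinearMap (M.measured C x b) i)

theorem expect_pairing_measured [Nonempty Y] (ρ : Op n d) (hb : ∀ k ∈ C, b k = 1) :
    𝔼 x, pairing ρ (M.measured C x b) = pairing ρ b := by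
  induction C using Finset.induction_on with
  | empty => exact expect_const univ_nonempty (pairing ρ b)
  | insert i C hi ih =>
    rw [← ih fun k hk => hb k (mem_insert_of_mem hk), expect_update i]
    refine expect_congr rfl fun x _ => ?_
    rw [expect_pairing_measured_insert M x b ρ hi, ← measured_update M x b hi,
      ← hb i (mem_insert_self i C), Function.update_eq_self]

end Measured

/-- The probability density, relative to the uniform distribution on `Fin n → Y`, of the outcomes
`x` when the sites in `C` of `ρ` are measured. -/
def prob (ρ : Op n d) (C : Finset (Fin n)) (x : Fin n → Y) : ℝ :=
  (pairing ρ (M.measured C x 1)).re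

section Prob

variable {ρ : Op n d}

theorem prob_nonneg (hρ : ρ.PosSemidef) (C : Finset (Fin n)) (x : Fin n → Y) :
    0 ≤ M.prob ρ C x :=
  (Complex.le_def.1 (pairing_nonneg hρ (M.measured_one_posSemidef C x))).1

theorem pairing_measured_one (hρ : ρ.PosSemidef) (C : Finset (Fin n)) (x : Fin n → Y) :
    pairing ρ (M.measured C x 1) = M.prob ρ C x :=
  Complex.eq_re_of_ofReal_le (r := 0)
    (by simpa using pairing_nonneg hρ (M.measured_one_posSemidef C x))

theorem expect_prob [Nonempty Y] (hρ : IsDensity ρ) (C : Finset (Fin n)) :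
    𝔼 x, M.prob ρ C x = 1 := by
  have h := expect_pairing_measured M (C := C) 1 ρ fun _ _ => rfl
  simp only [M.pairing_measured_one hρ.1, pairing_one, hρ.2] at h
  exact_mod_cast h

variable {C : Finset (Fin n)} {i : Fin n} (x : Fin n → Y)

theorem prob_update (ρ : Op n d) (hi : i ∉ C) (y : Y) :
    M.prob ρ C (Function.update x i y) = M.prob ρ C x := by
  rw [prob, measured_update_outcome M x 1 hi, prob]

theorem prob_insert_le (hρ : ρ.PosSemidef) (hi : i ∉ C) :
    M.prob ρ (insert i C) x ≤ K * M.prob ρ C x := by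
  have h : 0 ≤ pairing ρ (Function.update (M.measured C x 1) i
      ((K : ℂ) • 1 - M.effect (x i))) :=
    pairing_nonneg hρ (posSemidef_update (M.measured_one_posSemidef C x) i
      (M.bound_sub_effect_posSemidef _))
  rw [MultilinearMap.map_update_sub, MultilinearMap.map_update_smul, M.update_measured_one x hi,
    ← measured_insert, M.pairing_measured_one hρ, M.pairing_measured_one hρ, smul_eq_mul] at h
  exact sub_nonneg.1 (by exact_mod_cast h)

theorem prob_insert_eq_zero (hρ : ρ.PosSemidef) (hi : i ∉ C) (h : M.prob ρ C x = 0) :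
    M.prob ρ (insert i C) x = 0 :=
  le_antisymm (by simpa [h] using M.prob_insert_le x hρ hi) (M.prob_nonneg hρ _ x)

theorem expect_mul_prob_insert [Nonempty Y] (hρ : ρ.PosSemidef) (hi : i ∉ C)
    {F : (Fin n → Y) → ℝ} (hF : ∀ x y, F (Function.update x i y) = F x) :
    𝔼 x, F x * M.prob ρ (insert i C) x = 𝔼 x, F x * M.prob ρ C x := by
  rw [expect_update i]
  refine expect_congr rfl fun x _ => ?_
  simp only [hF, ← mul_expect]
  congr 1
  have h := expect_pairing_measured_insert M x 1 ρ hi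
  simp only [M.update_measured_one x hi, M.pairing_measured_one hρ] at h
  exact_mod_cast h

end Prob

end Measurement

namespace Measurement

variable {n d : ℕ} {Y : Type*} [Fintype Y] {K κ : ℝ} (M : Measurement d Y K)

section Covariance

variable {ρ : Op n d} {C : Finset (Fin n)} {i j : Fin n}

/-- The weighted squared covariance of the outcomes at `i` and `j` given those in `C`, relative to
the uniform distribution on outcomes. It is `0` where the condition has probability `0`. -/
def covariance (ρ : Op n d) (C : Finset (Fin n)) (i j : Fin n) (x : Fin n → Y) : ℝ :=
  (M.prob ρ (insert j (insert i C)) x -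
    M.prob ρ (insert i C) x * M.prob ρ (insert j C) x / M.prob ρ C x) ^ 2 / M.prob ρ C x

theorem covariance_nonneg (hρ : ρ.PosSemidef) (C : Finset (Fin n)) (i j : Fin n)
    (x : Fin n → Y) : 0 ≤ M.covariance ρ C i j x :=
  div_nonneg (sq_nonneg _) (M.prob_nonneg hρ C x)

/-- The mean square of the conditional outcome density at site `i` given the outcomes in `C`, which
measures how much these reveal about `i`. Measured sites get the largest possible value `K`, so
that the potential grows with `C`. -/
def potential (ρ : Op n d) (C : Finset (Fin n)) (i : Fin n) : ℝ :=
  if i ∈ C then K else 𝔼 x, M.prob ρ (insert i C) x ^ 2 / M.prob ρ C x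

theorem potential_of_notMem (ρ : Op n d) (hi : i ∉ C) :
    M.potential ρ C i = 𝔼 x, M.prob ρ (insert i C) x ^ 2 / M.prob ρ C x :=
  if_neg hi

theorem potential_nonneg [NeZero d] (hρ : ρ.PosSemidef) (C : Finset (Fin n)) (i : Fin n) :
    0 ≤ M.potential ρ C i := by
  unfold potential
  split_ifs
  · exact zero_le_one.trans M.one_le_bound
  · exact expect_nonneg fun x _ => div_nonneg (sq_nonneg _) (M.prob_nonneg hρ C x)

theorem potential_le [NeZero d] [Nonempty Y] (hρ : IsDensity ρ) (C : Finset (Fin n))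
    (i : Fin n) : M.potential ρ C i ≤ K := by
  unfold potential
  split_ifs with hi
  · exact le_rfl
  · calc 𝔼 x, M.prob ρ (insert i C) x ^ 2 / M.prob ρ C x
        ≤ 𝔼 x, K * M.prob ρ (insert i C) x := by
          refine expect_le_expect fun x _ => div_le_of_le_mul₀ (M.prob_nonneg hρ.1 C x)
            (mul_nonneg (zero_le_one.trans M.one_le_bound) (M.prob_nonneg hρ.1 _ x)) ?_
          nlinarith [M.prob_insert_le x hρ.1 hi, M.prob_nonneg hρ.1 (insert i C) x]
      _ = K := by rw [← mul_expect, M.expect_prob hρ, mul_one]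

theorem sq_div_le_of_le_mul {p q r s K : ℝ} (hp : 0 ≤ p) (hr : 0 ≤ r) (hs : 0 ≤ s)
    (hrp : r ≤ K * p) (hsr : s ≤ K * r) :
    (s - q * r / p) ^ 2 / p ≤ K * (s ^ 2 / r - 2 * (q / p * s) + (q / p) ^ 2 * r) := by
  rcases hr.eq_or_lt with rfl | hr
  · obtain rfl : s = 0 := by linarith
    simp
  rcases hp.eq_or_lt with rfl | hp
  · linarith
  have h : s ^ 2 / r - 2 * (q / p * s) + (q / p) ^ 2 * r = (s - q * r / p) ^ 2 / r := by
    field_simp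
    ring
  rw [h, ← mul_div_assoc, div_le_div_iff₀ hp hr]
  nlinarith [mul_le_mul_of_nonneg_left hrp (sq_nonneg (s - q * r / p))]

theorem expect_covariance_le [Nonempty Y] (hρ : ρ.PosSemidef) (hij : i ≠ j) (hi : i ∉ C)
    (hj : j ∉ C) :
    𝔼 x, M.covariance ρ C i j x ≤ K * (M.potential ρ (insert j C) i - M.potential ρ C i) := by
  have hi' : i ∉ insert j C := by simp [hij, hi]
  have hj' : j ∉ insert i C := by simp [hij.symm, hj]
  have hcross : 𝔼 x, M.prob ρ (insert i C) x / M.prob ρ C x *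
      M.prob ρ (insert j (insert i C)) x = M.potential ρ C i := by
    rw [M.expect_mul_prob_insert hρ hj' (F := fun x => M.prob ρ (insert i C) x / M.prob ρ C x)
      fun x y => by simp only [M.prob_update x ρ hj', M.prob_update x ρ hj],
      M.potential_of_notMem ρ hi]
    exact expect_congr rfl fun x _ => by ring
  have hsquare : 𝔼 x, (M.prob ρ (insert i C) x / M.prob ρ C x) ^ 2 * M.prob ρ (insert j C) x =
      M.potential ρ C i := by
    rw [M.expect_mul_prob_insert hρ hj
      (F := fun x => (M.prob ρ (insert i C) x / M.prob ρ C x) ^ 2)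
      fun x y => by simp only [M.prob_update x ρ hj', M.prob_update x ρ hj],
      M.potential_of_notMem ρ hi]
    refine expect_congr rfl fun x _ => ?_
    by_cases hp : M.prob ρ C x = 0
    · simp [hp]
    · field_simp
  calc 𝔼 x, M.covariance ρ C i j x
      ≤ 𝔼 x, K * (M.prob ρ (insert j (insert i C)) x ^ 2 / M.prob ρ (insert j C) x -
          2 * (M.prob ρ (insert i C) x / M.prob ρ C x * M.prob ρ (insert j (insert i C)) x) +
          (M.prob ρ (insert i C) x / M.prob ρ C x) ^ 2 * M.prob ρ (insert j C) x) := by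
        refine expect_le_expect fun x _ => sq_div_le_of_le_mul (M.prob_nonneg hρ _ x)
          (M.prob_nonneg hρ _ x) (M.prob_nonneg hρ _ x) (M.prob_insert_le x hρ hj) ?_
        rw [insert_comm]
        exact M.prob_insert_le x hρ hi'
    _ = K * (M.potential ρ (insert j C) i - M.potential ρ C i) := by
        rw [← mul_expect, expect_add_distrib, expect_sub_distrib, ← mul_expect, hcross, hsquare,
          M.potential_of_notMem ρ hi', insert_comm]
        ring

theorem potential_mono [NeZero d] [Nonempty Y] (hρ : IsDensity ρ) (C : Finset (Fin n))
    (i j : Fin n) : M.potential ρ C i ≤ M.potential ρ (insert j C) i := by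
  by_cases hi : i ∈ insert j C
  · exact (M.potential_le hρ C i).trans_eq (if_pos hi).symm
  obtain ⟨hij, hi⟩ : i ≠ j ∧ i ∉ C := by simpa using hi
  by_cases hj : j ∈ C
  · rw [insert_eq_of_mem hj]
  have hcov : 0 ≤ 𝔼 x, M.covariance ρ C i j x :=
    expect_nonneg fun x _ => M.covariance_nonneg hρ.1 C i j x
  exact sub_nonneg.1 <| nonneg_of_mul_nonneg_right
    (hcov.trans (M.expect_covariance_le hρ.1 hij hi hj)) (zero_lt_one.trans_le M.one_le_bound)

end Covariance

section Correlation

variable {ρ : Op n d} {C : Finset (Fin n)} {i j : Fin n}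

/-- The connected correlation of observables at the sites `i ≠ j` of `ρ` after the outcomes `x`
have been observed at the sites in `C`, multiplied by the probability of these outcomes. -/
def correlation (ρ : Op n d) (C : Finset (Fin n)) (x : Fin n → Y) (hij : i ≠ j) :
    Matrix (Fin d) (Fin d) ℂ →ₗ[ℂ] Matrix (Fin d) (Fin d) ℂ →ₗ[ℂ] ℂ :=
  pairFunctional ρ (M.measured C x 1) hij - (M.prob ρ C x : ℂ)⁻¹ •
    ((pairing ρ).toLinearMap (M.measured C x 1) i).smulRight
      ((pairing ρ).toLinearMap (M.measured C x 1) j)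

theorem correlation_apply (ρ : Op n d) (C : Finset (Fin n)) (x : Fin n → Y) (hij : i ≠ j)
    (B B' : Matrix (Fin d) (Fin d) ℂ) :
    M.correlation ρ C x hij B B' =
      pairFunctional ρ (M.measured C x 1) hij B B' - (M.prob ρ C x : ℂ)⁻¹ *
        (pairing ρ (Function.update (M.measured C x 1) i B) *
          pairing ρ (Function.update (M.measured C x 1) j B')) := rfl

theorem correlation_update (ρ : Op n d) {k : Fin n} (hk : k ∉ C) (x : Fin n → Y) (y : Y)
    (hij : i ≠ j) :
    M.correlation ρ C (Function.update x k y) hij = M.correlation ρ C x hij := by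
  simp only [correlation, M.measured_update_outcome x 1 hk, M.prob_update x ρ hk]

theorem norm_correlation_effect_sq (hρ : ρ.PosSemidef) (hij : i ≠ j) (hi : i ∉ C) (hj : j ∉ C)
    (x : Fin n → Y) :
    ‖M.correlation ρ C x hij (M.effect (x i)) (M.effect (x j))‖ ^ 2 =
      M.prob ρ C x * M.covariance ρ C i j x := by
  have hcorr : M.correlation ρ C x hij (M.effect (x i)) (M.effect (x j)) =
      ((M.prob ρ (insert j (insert i C)) x -
        M.prob ρ (insert i C) x * M.prob ρ (insert j C) x / M.prob ρ C x : ℝ) : ℂ) := by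
    rw [correlation_apply, pairFunctional_apply]
    simp only [← measured_insert, M.pairing_measured_one hρ]
    push_cast
    ring
  rw [hcorr, Complex.norm_real, Real.norm_eq_abs, sq_abs, covariance]
  by_cases hp : M.prob ρ C x = 0
  · have hpi := M.prob_insert_eq_zero x hρ hi hp
    have hpij := M.prob_insert_eq_zero x hρ (i := j) (by simp [hij.symm, hj]) hpi
    simp [hp, hpij]
  · field_simp

theorem sum_norm_correlation_sq_le (hM : M.IsFrame κ) (hρ : ρ.PosSemidef) (hij : i ≠ j)
    (hi : i ∉ C) (hj : j ∉ C) (x : Fin n → Y) :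
    ∑ u, ∑ v, ∑ u', ∑ v', ‖M.correlation ρ C x hij (single u v 1) (single u' v' 1)‖ ^ 2 ≤
      M.prob ρ C x * (κ ^ 2 * 𝔼 y, 𝔼 y',
        M.covariance ρ C i j (Function.update (Function.update x i y) j y')) := by
  have heffect (y y' : Y) : ‖M.correlation ρ C x hij (M.effect y) (M.effect y')‖ ^ 2 =
      M.prob ρ C x * M.covariance ρ C i j (Function.update (Function.update x i y) j y') := by
    have h := M.norm_correlation_effect_sq hρ hij hi hj
      (Function.update (Function.update x i y) j y')
    rwa [M.correlation_update ρ hj, M.correlation_update ρ hi, M.prob_update _ ρ hj,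
      M.prob_update _ ρ hi, Function.update_self, Function.update_of_ne hij,
      Function.update_self] at h
  refine (hM.sum_norm_sq_le₂ (M.correlation ρ C x hij)).trans_eq ?_
  simp only [heffect, ← mul_expect]
  ring

theorem sum_norm_expect_correlation_sq_le [Nonempty Y] (hM : M.IsFrame κ) (hρ : IsDensity ρ)
    (hij : i ≠ j) (hi : i ∉ C) (hj : j ∉ C) :
    ∑ u, ∑ v, ∑ u', ∑ v',
        ‖𝔼 x, M.correlation ρ C x hij (single u v 1) (single u' v' 1)‖ ^ 2 ≤
      κ ^ 2 * (K * (M.potential ρ (insert j C) i - M.potential ρ C i)) := by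
  have hcov := M.covariance_nonneg hρ.1 C i j
  have h := sum_norm_expect_sq_le (M.prob_nonneg hρ.1 C)
    (fun x => mul_nonneg (sq_nonneg κ) <| expect_nonneg fun y _ => expect_nonneg fun y' _ =>
      hcov (Function.update (Function.update x i y) j y'))
    (f := fun (e : Fin d × Fin d × Fin d × Fin d) x =>
      M.correlation ρ C x hij (single e.1 e.2.1 1) (single e.2.2.1 e.2.2.2 1))
    fun x => by
      simpa only [Fintype.sum_prod_type] using M.sum_norm_correlation_sq_le hM hρ.1 hij hi hj x
  simp only [Fintype.sum_prod_type] at h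
  refine h.trans ?_
  rw [M.expect_prob hρ, one_mul, ← mul_expect,
    ← expect_update i (f := fun x => 𝔼 y', M.covariance ρ C i j (Function.update x j y')),
    ← expect_update j]
  exact mul_le_mul_of_nonneg_left (M.expect_covariance_le hρ.1 hij hi hj) (sq_nonneg κ)

end Correlation

end Measurement

section Separable

variable {n d : ℕ}

theorem maximallyMixed_isDensity [NeZero d] :
    IsDensity ((d : ℂ)⁻¹ • (1 : Matrix (Fin d) (Fin d) ℂ)) :=
  ⟨PosSemidef.one.smul (by simp), by simp [trace_smul, NeZero.ne d]⟩

theorem GloballySeparable.isDensity {σ : Op n d} (hσ : GloballySeparable σ) : IsDensity σ := by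
  obtain ⟨m, p, s, hp, hp1, hs, rfl⟩ := hσ
  refine ⟨posSemidef_sum _ fun z _ =>
    (tensorOp_isDensity (hs z)).1.smul (by exact_mod_cast hp z), ?_⟩
  simp only [trace_sum, trace_smul, (tensorOp_isDensity (hs _)).2, smul_eq_mul, mul_one]
  exact_mod_cast hp1

theorem globallySeparable_of_fintype {X : Type*} [Fintype X] {p : X → ℝ}
    {s : X → Fin n → Matrix (Fin d) (Fin d) ℂ} (hp : ∀ x, 0 ≤ p x) (hp1 : ∑ x, p x = 1)
    (hs : ∀ x k, IsDensity (s x k)) :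
    GloballySeparable (∑ x, (p x : ℂ) • tensorOp (s x)) := by
  let e := (Fintype.equivFin X).symm
  exact ⟨Fintype.card X, p ∘ e, s ∘ e, fun z => hp (e z), (e.sum_comp p).trans hp1,
    fun z => hs (e z), (e.sum_comp fun x => (p x : ℂ) • tensorOp (s x)).symm⟩

end Separable

namespace Measurement

variable {n d : ℕ} {Y : Type*} [Fintype Y] {K κ : ℝ} (M : Measurement d Y K)

section ConditionalState

variable {ρ : Op n d} {C : Finset (Fin n)} {k : Fin n}

/-- The state of site `k` after the outcomes `x` have been observed at the sites in `C`, or the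
maximally mixed state if `k` has been measured or the outcomes have probability `0`. -/
def conditionalState (ρ : Op n d) (C : Finset (Fin n)) (x : Fin n → Y) (k : Fin n) :
    Matrix (Fin d) (Fin d) ℂ :=
  if k ∈ C ∨ M.prob ρ C x = 0 then (d : ℂ)⁻¹ • 1
  else (M.prob ρ C x : ℂ)⁻¹ • reduced ρ (M.measured C x 1) k

theorem trace_reduced_measured (hρ : ρ.PosSemidef) (hk : k ∉ C) (x : Fin n → Y) :
    (reduced ρ (M.measured C x 1) k).trace = M.prob ρ C x := by
  rw [← mul_one (reduced _ _ _), trace_reduced_mul, M.update_measured_one x hk,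
    M.pairing_measured_one hρ]

theorem conditionalState_isDensity [NeZero d] (hρ : ρ.PosSemidef) (C : Finset (Fin n))
    (x : Fin n → Y) (k : Fin n) : IsDensity (M.conditionalState ρ C x k) := by
  unfold conditionalState
  split_ifs with h
  · exact maximallyMixed_isDensity
  · obtain ⟨hk, hp⟩ := not_or.1 h
    constructor
    · refine (reduced_posSemidef hρ (M.measured_one_posSemidef C x) k).smul ?_
      exact_mod_cast inv_nonneg.2 (M.prob_nonneg hρ C x)
    · rw [trace_smul, M.trace_reduced_measured hρ hk, smul_eq_mul, inv_mul_cancel₀]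
      exact_mod_cast hp

theorem prob_mul_trace_conditionalState_mul (hρ : ρ.PosSemidef) (hk : k ∉ C) (x : Fin n → Y)
    (B : Matrix (Fin d) (Fin d) ℂ) :
    (M.prob ρ C x : ℂ) * (M.conditionalState ρ C x k * B).trace =
      pairing ρ (Function.update (M.measured C x 1) k B) := by
  rw [← trace_reduced_mul]
  by_cases hp : M.prob ρ C x = 0
  · have hzero : reduced ρ (M.measured C x 1) k = 0 := by
      rw [← (reduced_posSemidef hρ (M.measured_one_posSemidef C x) k).trace_eq_zero_iff,
        M.trace_reduced_measured hρ hk, hp, Complex.ofReal_zero]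
    simp [hp, hzero]
  · rw [conditionalState, if_neg (not_or.2 ⟨hk, hp⟩), Matrix.smul_mul, trace_smul, smul_eq_mul,
      mul_inv_cancel_left₀ (by exact_mod_cast hp)]

end ConditionalState

section Rounded

variable {ρ : Op n d} {C : Finset (Fin n)} {i j : Fin n}

/-- The mixture, over the outcomes of measuring the sites in `C`, of the products of the
conditional single-site states: the separable state that approximates `ρ`. -/
def rounded (ρ : Op n d) (C : Finset (Fin n)) : Op n d :=
  ∑ x, ((M.prob ρ C x / Fintype.card (Fin n → Y) : ℝ) : ℂ) • tensorOp (M.conditionalState ρ C x)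

theorem rounded_globallySeparable [NeZero d] [Nonempty Y] (hρ : IsDensity ρ)
    (C : Finset (Fin n)) : GloballySeparable (M.rounded ρ C) := by
  refine globallySeparable_of_fintype
    (fun x => div_nonneg (M.prob_nonneg hρ.1 C x) (Nat.cast_nonneg _)) ?_
    fun x k => M.conditionalState_isDensity hρ.1 C x k
  rw [← sum_div, ← Fintype.expect_eq_sum_div_card, M.expect_prob hρ]

theorem pairing_rounded (ρ : Op n d) (C : Finset (Fin n))
    (a : Fin n → Matrix (Fin d) (Fin d) ℂ) :
    pairing (M.rounded ρ C) a =
      𝔼 x, (M.prob ρ C x : ℂ) * ∏ k, (M.conditionalState ρ C x k * a k).trace := by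
  simp only [pairing_apply, rounded, sum_mul, Matrix.smul_mul, trace_sum, trace_smul]
  simp only [← pairing_apply, pairing_tensorOp, Fintype.expect_eq_sum_div_card, sum_div,
    smul_eq_mul, Complex.ofReal_div, Complex.ofReal_natCast, div_mul_eq_mul_div]

theorem pairing_rounded_single [NeZero d] [Nonempty Y] (hρ : ρ.PosSemidef) (hi : i ∉ C)
    (B : Matrix (Fin d) (Fin d) ℂ) :
    pairing (M.rounded ρ C) (Function.update 1 i B) = pairing ρ (Function.update 1 i B) := by
  rw [pairing_rounded, ← M.expect_pairing_measured (C := C) (Function.update 1 i B) ρ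
    fun k hk => Function.update_of_ne (ne_of_mem_of_not_mem hk hi) _ _]
  refine expect_congr rfl fun x _ => ?_
  rw [Fintype.prod_eq_single i fun k hk => ?_, Function.update_self,
    M.prob_mul_trace_conditionalState_mul hρ hi, M.measured_update x 1 hi]
  rw [Function.update_of_ne hk, Pi.one_apply, mul_one,
    (M.conditionalState_isDensity hρ C x k).2]

theorem pairFunctional_sub_rounded [NeZero d] [Nonempty Y] (hρ : ρ.PosSemidef) (hij : i ≠ j)
    (hi : i ∉ C) (hj : j ∉ C) (B B' : Matrix (Fin d) (Fin d) ℂ) :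
    pairFunctional (ρ - M.rounded ρ C) 1 hij B B' = 𝔼 x, M.correlation ρ C x hij B B' := by
  rw [pairFunctional_apply, pairing_sub, pairing_rounded, ← M.expect_pairing_measured (C := C)
    (Function.update (Function.update 1 i B) j B') ρ fun k hk => by
      rw [Function.update_of_ne (ne_of_mem_of_not_mem hk hj),
        Function.update_of_ne (ne_of_mem_of_not_mem hk hi), Pi.one_apply], ← expect_sub_distrib]
  refine expect_congr rfl fun x _ => ?_
  have hprod : ∏ k, (M.conditionalState ρ C x k *
      Function.update (Function.update (1 : Fin n → Matrix (Fin d) (Fin d) ℂ) i B) j B' k).trace =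
        (M.conditionalState ρ C x i * B).trace * (M.conditionalState ρ C x j * B').trace := by
    rw [Fintype.prod_eq_mul i j hij fun k hk => ?_, Function.update_self,
      Function.update_of_ne hij, Function.update_self]
    rw [Function.update_of_ne hk.2, Function.update_of_ne hk.1, Pi.one_apply, mul_one,
      (M.conditionalState_isDensity hρ C x k).2]
  rw [hprod, correlation_apply, pairFunctional_apply, M.measured_update x _ hj,
    M.measured_update x _ hi, ← M.prob_mul_trace_conditionalState_mul hρ hi,
    ← M.prob_mul_trace_conditionalState_mul hρ hj]
  congr 1
  by_cases hp : (M.prob ρ C x : ℂ) = 0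
  · simp [hp]
  · field_simp

theorem traceNorm_marginal_sub_rounded_sq_le [NeZero d] [Nonempty Y] (hM : M.IsFrame κ)
    (hρ : IsDensity ρ) (hi : i ∉ C) (hj : j ∉ C) :
    traceNorm (marginal {i, j} ρ - marginal {i, j} (M.rounded ρ C)) ^ 2 ≤
      d ^ 2 * κ ^ 2 * K * (M.potential ρ (insert j C) i - M.potential ρ C i) := by
  rw [← marginal_sub]
  obtain rfl | hij := eq_or_ne i j
  · have hzero : marginal {i} (ρ - M.rounded ρ C) = 0 := marginal_singleton_eq_zero fun B => by
      rw [pairing_sub, M.pairing_rounded_single hρ.1 hi, sub_self]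
    have hK : 0 ≤ K := zero_le_one.trans M.one_le_bound
    have hgain := sub_nonneg.2 (M.potential_mono hρ C i i)
    rw [pair_eq_singleton, hzero, traceNorm_zero, zero_pow two_ne_zero]
    positivity
  · refine (traceNorm_marginal_pair_sq_le hij _).trans ?_
    simp only [M.pairFunctional_sub_rounded hρ.1 hij hi hj]
    simp only [mul_assoc]
    gcongr
    exact M.sum_norm_expect_correlation_sq_le hM hρ hij hi hj

end Rounded

end Measurement

section Graph

variable {n : ℕ} {G : Matrix (Fin n) (Fin n) ℝ}

theorem stationary_nonneg (hG : ∀ i j, 0 ≤ G i j) (j : Fin n) : 0 ≤ stationary G j :=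
  sum_nonneg fun i _ => hG i j

theorem sum_stationary (G : Matrix (Fin n) (Fin n) ℝ) :
    ∑ j, stationary G j = ∑ i, ∑ j, G i j :=
  sum_comm

theorem sum_row_eq_stationary (hGsymm : G.IsSymm) (i : Fin n) : ∑ j, G i j = stationary G i :=
  sum_congr rfl fun j _ => hGsymm.apply j i

theorem walkMatrix_nonneg (hG : ∀ i j, 0 ≤ G i j) (i j : Fin n) : 0 ≤ walkMatrix G i j :=
  div_nonneg (hG i j) (stationary_nonneg hG j)

theorem trace_walkMatrix_sq_nonneg (hG : ∀ i j, 0 ≤ G i j) :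
    0 ≤ (walkMatrix G * walkMatrix G).trace :=
  sum_nonneg fun i _ => dotProduct_nonneg_of_nonneg (walkMatrix_nonneg hG i)
    fun j => walkMatrix_nonneg hG j i

theorem walkMatrix_mul_stationary (hG : ∀ i j, 0 ≤ G i j) (i j : Fin n) :
    walkMatrix G i j * stationary G j = G i j := by
  rw [walkMatrix, of_apply]
  refine div_mul_cancel_of_imp fun hj => ?_
  exact (sum_eq_zero_iff_of_nonneg fun k _ => hG k j).1 hj i (mem_univ i)

theorem sq_sum_mul_le_trace (hGsymm : G.IsSymm) (hG : ∀ i j, 0 ≤ G i j)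
    (y : Fin n → Fin n → ℝ) :
    (∑ i, ∑ j, G i j * y i j) ^ 2 ≤ (walkMatrix G * walkMatrix G).trace *
      ∑ i, ∑ j, stationary G i * stationary G j * y i j ^ 2 := by
  have hA := walkMatrix_nonneg hG
  have hπ := stationary_nonneg hG
  simp only [trace, diag_apply, mul_apply, ← Fintype.sum_prod_type']
  refine sum_sq_le_sum_mul_sum_of_sq_le_mul _ (fun q _ => mul_nonneg (hA _ _) (hA _ _))
    (fun q _ => mul_nonneg (mul_nonneg (hπ _) (hπ _)) (sq_nonneg _)) fun ⟨i, j⟩ _ => le_of_eq ?_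
  calc (G i j * y i j) ^ 2 = G i j * G j i * y i j ^ 2 := by
        rw [hGsymm.apply]
        ring
    _ = (walkMatrix G i j * stationary G j) * (walkMatrix G j i * stationary G i) *
          y i j ^ 2 := by
        rw [walkMatrix_mul_stationary hG, walkMatrix_mul_stationary hG]
    _ = walkMatrix G i j * walkMatrix G j i *
          (stationary G i * stationary G j * y i j ^ 2) := by ring

theorem sum_mul_sqrt_le (hGsymm : G.IsSymm) (hG : ∀ i j, 0 ≤ G i j) {y : Fin n → Fin n → ℝ}
    (hy : ∀ i j, 0 ≤ y i j) :
    ∑ i, ∑ j, G i j * √(y i j) ≤ √((walkMatrix G * walkMatrix G).trace *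
      ∑ i, ∑ j, stationary G i * stationary G j * y i j) := by
  refine Real.le_sqrt_of_sq_le ((sq_sum_mul_le_trace hGsymm hG fun i j => √(y i j)).trans_eq ?_)
  simp only [Real.sq_sqrt (hy _ _)]

theorem one_le_trace_walkMatrix_sq (hGsymm : G.IsSymm) (hG : ∀ i j, 0 ≤ G i j)
    (hGsum : ∑ i, ∑ j, G i j = 1) : 1 ≤ (walkMatrix G * walkMatrix G).trace := by
  have hCS := sq_sum_mul_le_trace hGsymm hG fun _ _ => 1
  simpa only [mul_one, hGsum, one_pow, ← mul_sum, (sum_stationary G).trans hGsum] using hCS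

theorem sum_stationary_sq_pos (hGsum : ∑ i, ∑ j, G i j = 1) : 0 < ∑ j, stationary G j ^ 2 := by
  obtain ⟨j, -, hj⟩ := exists_ne_zero_of_sum_ne_zero
    (by rw [sum_stationary, hGsum]; exact one_ne_zero : ∑ j, stationary G j ≠ 0)
  exact sum_pos' (fun j _ => sq_nonneg _) ⟨j, mem_univ j, by positivity⟩

theorem sum_mul_indicator_add (hGsymm : G.IsSymm) (C : Finset (Fin n)) :
    ∑ i, ∑ j, G i j * ((if i ∈ C then 1 else 0) + if j ∈ C then 1 else 0) =
      2 * ∑ i ∈ C, stationary G i := by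
  have hrow : ∑ i, ∑ j, G i j * (if i ∈ C then 1 else 0) = ∑ i ∈ C, stationary G i := by
    simp_rw [← sum_mul, sum_row_eq_stationary hGsymm, mul_ite, mul_one, mul_zero, sum_ite_mem,
      univ_inter]
  have hcol : ∑ i, ∑ j, G i j * (if j ∈ C then 1 else 0) = ∑ j ∈ C, stationary G j := by
    rw [sum_comm]
    simp_rw [← sum_mul, mul_ite, mul_one, mul_zero, sum_ite_mem, univ_inter, stationary]
  simp only [mul_add, sum_add_distrib, hrow, hcol, two_mul]

end Graph

/- A set `C` minimizing `K μ π(C) - ∑ i, π i * Φ C i` works: comparison with `∅` bounds `π(C)`, and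
comparison with `insert j C` bounds the gain from adding `j`. -/
theorem exists_conditioning_set {V : Type*} [Fintype V] [DecidableEq V] {π : V → ℝ}
    (hπ : ∀ i, 0 ≤ π i) (hπ1 : ∑ i, π i = 1) {K : ℝ} (hK : 0 < K) {Φ : Finset V → V → ℝ}
    (hΦ : ∀ C i, 0 ≤ Φ C i) (hΦK : ∀ C i, Φ C i ≤ K) {μ : ℝ} (hμ : 0 < μ) :
    ∃ C : Finset V, ∑ i ∈ C, π i ≤ 1 / μ ∧
      ∑ i, ∑ j, π i * π j * (Φ (insert j C) i - Φ C i) ≤ K * μ * ∑ j, π j ^ 2 := by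
  obtain ⟨C, -, hmin⟩ := exists_min_image (univ : Finset (Finset V))
    (fun C => K * μ * ∑ i ∈ C, π i - ∑ i, π i * Φ C i) univ_nonempty
  refine ⟨C, ?_, ?_⟩
  · have hempty := hmin ∅ (mem_univ _)
    have hupper : ∑ i, π i * Φ C i ≤ K := by
      calc ∑ i, π i * Φ C i ≤ ∑ i, π i * K :=
            sum_le_sum fun i _ => mul_le_mul_of_nonneg_left (hΦK C i) (hπ i)
        _ = K := by rw [← sum_mul, hπ1, one_mul]
    have hlower : 0 ≤ ∑ i, π i * Φ ∅ i := sum_nonneg fun i _ => mul_nonneg (hπ i) (hΦ ∅ i)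
    rw [sum_empty, mul_zero] at hempty
    rw [le_div_iff₀ hμ]
    refine le_of_mul_le_mul_left ?_ hK
    linarith
  · rw [sum_comm, mul_sum]
    refine sum_le_sum fun j _ => ?_
    have hinsert := hmin (insert j C) (mem_univ _)
    have hweight : ∑ i ∈ insert j C, π i ≤ π j + ∑ i ∈ C, π i := by
      by_cases hj : j ∈ C
      · rw [insert_eq_of_mem hj]
        exact le_add_of_nonneg_left (hπ j)
      · rw [sum_insert hj]
    have hscaled := mul_le_mul_of_nonneg_left hweight (mul_pos hK hμ).le
    calc ∑ i, π i * π j * (Φ (insert j C) i - Φ C i)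
        = π j * (∑ i, π i * Φ (insert j C) i - ∑ i, π i * Φ C i) := by
          rw [← sum_sub_distrib, mul_sum]
          exact sum_congr rfl fun i _ => by ring
      _ ≤ π j * (K * μ * π j) := mul_le_mul_of_nonneg_left (by linarith) (hπ j)
      _ = K * μ * π j ^ 2 := by ring

namespace Measurement

variable {n d : ℕ} {Y : Type*} [Fintype Y] {K κ : ℝ} (M : Measurement d Y K) {ρ : Op n d}

theorem traceNorm_marginal_sub_rounded_le [NeZero d] [Nonempty Y] (hM : M.IsFrame κ)
    (hρ : IsDensity ρ) (C : Finset (Fin n)) (i j : Fin n) :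
    traceNorm (marginal {i, j} ρ - marginal {i, j} (M.rounded ρ C)) ≤
      √(d ^ 2 * κ ^ 2 * K * (M.potential ρ (insert j C) i - M.potential ρ C i)) +
        2 * ((if i ∈ C then 1 else 0) + if j ∈ C then 1 else 0) := by
  have htwo := traceNorm_sub_le_two (marginal_isDensity {i, j} hρ)
    (marginal_isDensity {i, j} (M.rounded_globallySeparable hρ C).isDensity)
  have hsqrt := Real.sqrt_nonneg
    (d ^ 2 * κ ^ 2 * K * (M.potential ρ (insert j C) i - M.potential ρ C i))
  by_cases hi : i ∈ C
  · rw [if_pos hi]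
    split_ifs <;> linarith
  by_cases hj : j ∈ C
  · rw [if_pos hj, if_neg hi]
    linarith
  · rw [if_neg hi, if_neg hj, add_zero, mul_zero, add_zero]
    exact Real.le_sqrt_of_sq_le (M.traceNorm_marginal_sub_rounded_sq_le hM hρ hi hj)

theorem exists_sum_traceNorm_rounded_le [NeZero d] [Nonempty Y] (hM : M.IsFrame κ)
    (hρ : IsDensity ρ) {G : Matrix (Fin n) (Fin n) ℝ} (hGsymm : G.IsSymm)
    (hG : ∀ i j, 0 ≤ G i j) (hGsum : ∑ i, ∑ j, G i j = 1) {μ : ℝ} (hμ : 0 < μ) :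
    ∃ C, ∑ i, ∑ j, G i j * traceNorm (marginal {i, j} ρ - marginal {i, j} (M.rounded ρ C)) ≤
      d * κ * K * √((walkMatrix G * walkMatrix G).trace * (∑ j, stationary G j ^ 2) * μ) +
        4 / μ := by
  have hK : 0 < K := zero_lt_one.trans_le M.one_le_bound
  obtain ⟨C, hhit, hgain⟩ := exists_conditioning_set (stationary_nonneg hG)
    ((sum_stationary G).trans hGsum) hK (M.potential_nonneg hρ.1) (M.potential_le hρ) hμ
  refine ⟨C, ?_⟩
  set c := (d ^ 2 * κ ^ 2 * K : ℝ)
  set Δ := fun i j => M.potential ρ (insert j C) i - M.potential ρ C i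
  have hc : 0 ≤ c := by positivity
  have hmain : ∑ i, ∑ j, G i j * √(c * Δ i j) ≤
      d * κ * K * √((walkMatrix G * walkMatrix G).trace * (∑ j, stationary G j ^ 2) * μ) := by
    calc ∑ i, ∑ j, G i j * √(c * Δ i j)
        ≤ √((walkMatrix G * walkMatrix G).trace *
            ∑ i, ∑ j, stationary G i * stationary G j * (c * Δ i j)) :=
          sum_mul_sqrt_le hGsymm hG fun i j =>
            mul_nonneg hc (sub_nonneg.2 (M.potential_mono hρ C i j))
      _ ≤ √((walkMatrix G * walkMatrix G).trace *
            (c * (K * μ * ∑ j, stationary G j ^ 2))) := by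
          simp only [mul_left_comm _ c, ← mul_sum]
          gcongr
          exact trace_walkMatrix_sq_nonneg hG
      _ = √((d * κ * K) ^ 2 *
            ((walkMatrix G * walkMatrix G).trace * (∑ j, stationary G j ^ 2) * μ)) := by
          congr 1
          ring
      _ = _ := by
          rw [Real.sqrt_mul (sq_nonneg _), Real.sqrt_sq]
          have := hM.nonneg
          positivity
  calc ∑ i, ∑ j, G i j * traceNorm (marginal {i, j} ρ - marginal {i, j} (M.rounded ρ C))
      ≤ ∑ i, ∑ j, G i j * (√(c * Δ i j) +
          2 * ((if i ∈ C then 1 else 0) + if j ∈ C then 1 else 0)) :=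
        sum_le_sum fun i _ => sum_le_sum fun j _ => mul_le_mul_of_nonneg_left
          (M.traceNorm_marginal_sub_rounded_le hM hρ C i j) (hG i j)
    _ = ∑ i, ∑ j, G i j * √(c * Δ i j) + 2 * (2 * ∑ i ∈ C, stationary G i) := by
        simp only [← sum_mul_indicator_add hGsymm C, mul_add, sum_add_distrib, mul_sum,
          mul_left_comm (2 : ℝ)]
    _ ≤ _ := by
        gcongr
        linarith [show 4 / μ = 4 * (1 / μ) by ring]

end Measurement

section ProbeMeasurement

variable {d : ℕ}

/-- The fourth roots of unity. -/
def phase : Fin 4 → ℂ := ![1, Complex.I, -1, -Complex.I]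

theorem sum_phase : ∑ z, phase z = 0 := by
  simp [Fin.sum_univ_four, phase]

theorem phase_mul_star (z : Fin 4) : phase z * star (phase z) = 1 := by
  fin_cases z <;> simp [phase]

theorem sum_norm_phase_combination_sq (A s t : ℂ) :
    ∑ z, ‖A + star (phase z) * s + phase z * t‖ ^ 2 = 4 * (‖A‖ ^ 2 + ‖s‖ ^ 2 + ‖t‖ ^ 2) := by
  simp only [Fin.sum_univ_four, phase, cons_val_zero, cons_val_one, Matrix.cons_val,
    Complex.star_def, map_one, map_neg, Complex.conj_I]
  simp only [← Complex.normSq_eq_norm_sq, Complex.normSq_apply, one_mul, neg_mul, neg_neg,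
    Complex.add_re, Complex.add_im, Complex.neg_re, Complex.neg_im, Complex.mul_re, Complex.mul_im,
    Complex.I_re, Complex.I_im, zero_mul, zero_add, zero_sub]
  ring

/-- The unnormalized vector `e_a + ω e_b`, for basis labels `a`, `b` and a fourth root of
unity `ω`. -/
def probe (y : Fin d × Fin d × Fin 4) : Fin d → ℂ :=
  Pi.single y.1 1 + phase y.2.2 • Pi.single y.2.1 1

/-- The rank-one effects of the probes, normalized so that their average is the identity. -/
def probeEffect (y : Fin d × Fin d × Fin 4) : Matrix (Fin d) (Fin d) ℂ :=
  (d / 2 : ℂ) • proj (probe y)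

theorem proj_single_add (a b : Fin d) (c : ℂ) :
    proj (Pi.single a 1 + c • Pi.single b 1 : Fin d → ℂ) =
      single a a 1 + (c * star c) • single b b 1 + star c • single a b 1 + c • single b a 1 := by
  simp only [proj, star_add, star_smul, Pi.star_single, star_one, vecMulVec_add, add_vecMulVec,
    smul_vecMulVec, vecMulVec_smul, single_eq_single_vecMulVec_single]
  module

theorem probeEffect_eq (y : Fin d × Fin d × Fin 4) :
    probeEffect y = (d / 2 : ℂ) • (single y.1 y.1 1 + single y.2.1 y.2.1 1 +
      star (phase y.2.2) • single y.1 y.2.1 1 + phase y.2.2 • single y.2.1 y.1 1) := by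
  rw [probeEffect, probe, proj_single_add, phase_mul_star, one_smul]

theorem sum_probeEffect :
    ∑ y, probeEffect y =
      (Fintype.card (Fin d × Fin d × Fin 4) : ℂ) • (1 : Matrix (Fin d) (Fin d) ℂ) := by
  have hstar : ∑ z, star (phase z) = 0 := by rw [← star_sum, sum_phase, star_zero]
  simp only [probeEffect_eq, Fintype.sum_prod_type, ← smul_sum, sum_add_distrib, ← sum_smul,
    sum_phase, hstar, zero_smul, sum_const_zero, sum_const, card_univ, sum_single_one,
    Fintype.card_prod, Fintype.card_fin, ← Nat.cast_smul_eq_nsmul ℂ, smul_smul, ← add_smul,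
    add_zero]
  congr 1
  push_cast
  ring

theorem one_sub_single_posSemidef (a : Fin d) :
    (1 - single a a 1 : Matrix (Fin d) (Fin d) ℂ).PosSemidef := by
  rw [← diagonal_one, ← diagonal_single, diagonal_sub]
  refine PosSemidef.diagonal fun u => ?_
  obtain rfl | hu := eq_or_ne u a
  · simp
  · simp [hu]

theorem two_mul_sub_probeEffect_posSemidef (y : Fin d × Fin d × Fin 4) :
    ((2 * d : ℂ) • (1 : Matrix (Fin d) (Fin d) ℂ) - probeEffect y).PosSemidef := by
  have h : (2 * d : ℂ) • (1 : Matrix (Fin d) (Fin d) ℂ) - probeEffect y =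
      (d / 2 : ℂ) • (proj (Pi.single y.1 1 + (-phase y.2.2) • Pi.single y.2.1 1) +
        (2 : ℂ) • ((1 - single y.1 y.1 1) + (1 - single y.2.1 y.2.1 1))) := by
    rw [probeEffect_eq, proj_single_add, star_neg, neg_mul_neg, phase_mul_star]
    module
  rw [h]
  exact ((proj_posSemidef _).add (((one_sub_single_posSemidef _).add
    (one_sub_single_posSemidef _)).smul (by norm_num))).smul (by positivity)

/-- The measurement with one outcome for every probe `e_a + ω e_b`; by polarization these determine
every matrix entry. -/
def probeMeasurement (d : ℕ) [NeZero d] : Measurement d (Fin d × Fin d × Fin 4) (2 * d) where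
  effect := probeEffect
  effect_posSemidef y := (proj_posSemidef _).smul (by positivity)
  expect_effect := by
    rw [Finset.expect, sum_probeEffect, Nat.cast_smul_eq_nsmul, ← card_univ,
      ← Nat.cast_smul_eq_nsmul ℚ≥0, smul_smul,
      inv_mul_cancel₀ (Nat.cast_ne_zero.2 (card_ne_zero.2 univ_nonempty)), one_smul]
  bound_sub_effect_posSemidef y := by
    simpa using two_mul_sub_probeEffect_posSemidef y

theorem sum_norm_probeEffect_sq_ge (L : Matrix (Fin d) (Fin d) ℂ →ₗ[ℂ] ℂ) (a b : Fin d) :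
    (d : ℝ) ^ 2 * (‖L (single a b 1)‖ ^ 2 + ‖L (single b a 1)‖ ^ 2) ≤
      ∑ z, ‖L (probeEffect (a, b, z))‖ ^ 2 := by
  simp only [probeEffect_eq, map_smul, map_add, smul_eq_mul, norm_mul, mul_pow, ← mul_sum,
    sum_norm_phase_combination_sq, norm_div, Complex.norm_natCast, Complex.norm_ofNat]
  nlinarith [sq_nonneg (‖L (single a a 1) + L (single b b 1)‖ * d)]

theorem probeMeasurement_isFrame [NeZero d] : (probeMeasurement d).IsFrame 2 where
  nonneg := zero_le_two
  sum_norm_sq_le L := by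
    have hd : (0 : ℝ) < d := by exact_mod_cast NeZero.pos d
    have hsum : 2 * d ^ 2 * ∑ u, ∑ v, ‖L (single u v 1)‖ ^ 2 ≤
        ∑ y, ‖L (probeEffect y)‖ ^ 2 := by
      calc 2 * d ^ 2 * ∑ u, ∑ v, ‖L (single u v 1)‖ ^ 2
          = ∑ a, ∑ b, (d : ℝ) ^ 2 * (‖L (single a b 1)‖ ^ 2 + ‖L (single b a 1)‖ ^ 2) := by
            simp only [← mul_sum, sum_add_distrib]
            rw [sum_comm (f := fun a b => ‖L (single b a 1)‖ ^ 2)]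
            ring
        _ ≤ ∑ y, ‖L (probeEffect y)‖ ^ 2 := by
            simp only [Fintype.sum_prod_type]
            exact sum_le_sum fun a _ => sum_le_sum fun b _ => sum_norm_probeEffect_sq_ge L a b
    rw [Fintype.expect_eq_sum_div_card, ← mul_div_assoc]
    simp only [Fintype.card_prod, Fintype.card_fin]
    push_cast
    rw [le_div_iff₀ (by positivity)]
    change _ ≤ 2 * ∑ y, ‖L (probeEffect y)‖ ^ 2
    linarith

end ProbeMeasurement

section Approximation

variable {n d : ℕ} {G : Matrix (Fin n) (Fin n) ℝ}

/-- A sharper error than `errorBound`: the exponent is `1 / 3` instead of `1 / 8`, and the error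
never exceeds the trivial bound `2`. -/
def cubeRootError (d : ℕ) (G : Matrix (Fin n) (Fin n) ℝ) : ℝ :=
  min 2 (10 * ((d : ℝ) ^ 4 * Real.log d * (walkMatrix G * walkMatrix G).trace *
    ∑ j, stationary G j ^ 2) ^ (1 / 3 : ℝ))

theorem cubeRootError_nonneg (d : ℕ) (hG : ∀ i j, 0 ≤ G i j) : 0 ≤ cubeRootError d G := by
  have hT := trace_walkMatrix_sq_nonneg hG
  have := Real.log_natCast_nonneg d
  unfold cubeRootError
  positivity

theorem cubeRootError_le_errorBound (d : ℕ) (hG : ∀ i j, 0 ≤ G i j) :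
    cubeRootError d G ≤ errorBound d G := by
  have hT := trace_walkMatrix_sq_nonneg hG
  have := Real.log_natCast_nonneg d
  have hs : 0 ≤ ∑ j, stationary G j ^ 2 := sum_nonneg fun j _ => sq_nonneg _
  unfold cubeRootError errorBound
  set x := (d : ℝ) ^ 4 * Real.log d * (walkMatrix G * walkMatrix G).trace *
    ∑ j, stationary G j ^ 2
  have hx : 0 ≤ x := by positivity
  rcases le_total 1 x with hx1 | hx1
  · have := Real.one_le_rpow hx1 (by norm_num : (0 : ℝ) ≤ 1 / 8)
    exact (min_le_left _ _).trans (by linarith)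
  · have := Real.rpow_le_rpow_of_exponent_ge' hx hx1 (by norm_num : (0 : ℝ) ≤ 1 / 8)
      (by norm_num : (1 / 8 : ℝ) ≤ 1 / 3)
    have := Real.rpow_nonneg hx (1 / 8)
    exact (min_le_right _ _).trans (by linarith)

theorem IsDensity.eq_of_subsingleton {ι : Type*} [Fintype ι] [Subsingleton ι]
    {ρ σ : Matrix ι ι ℂ} (hρ : IsDensity ρ) (hσ : IsDensity σ) : ρ = σ := by
  ext u v
  obtain rfl := Subsingleton.elim u v
  simpa [trace, Fintype.sum_subsingleton _ u] using hρ.2.trans hσ.2.symm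

theorem sum_mul_traceNorm_sub_le_two (hG : ∀ i j, 0 ≤ G i j) (hGsum : ∑ i, ∑ j, G i j = 1)
    {ρ σ : Op n d} (hρ : IsDensity ρ) (hσ : IsDensity σ) :
    ∑ i, ∑ j, G i j * traceNorm (marginal {i, j} ρ - marginal {i, j} σ) ≤ 2 := by
  calc ∑ i, ∑ j, G i j * traceNorm (marginal {i, j} ρ - marginal {i, j} σ)
      ≤ ∑ i, ∑ j, G i j * 2 := sum_le_sum fun i _ => sum_le_sum fun j _ =>
        mul_le_mul_of_nonneg_left
          (traceNorm_sub_le_two (marginal_isDensity _ hρ) (marginal_isDensity _ hσ)) (hG i j)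
    _ = 2 := by simp only [← sum_mul, hGsum, one_mul]

theorem sqrt_mul_inv_cubeRoot {t : ℝ} (ht : 0 < t) :
    √(t * (t ^ (1 / 3 : ℝ))⁻¹) = t ^ (1 / 3 : ℝ) := by
  have hsq : t * (t ^ (1 / 3 : ℝ))⁻¹ = (t ^ (1 / 3 : ℝ)) ^ 2 := by
    rw [← Real.rpow_neg ht.le, ← Real.rpow_one_add' ht.le (by norm_num),
      ← Real.rpow_mul_natCast ht.le]
    norm_num
  rw [hsq, Real.sqrt_sq (Real.rpow_nonneg ht.le _)]

theorem four_fifths_le_log_rpow (hd : 2 ≤ d) : 4 / 5 ≤ Real.log d ^ (1 / 3 : ℝ) := by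
  have hlog : (4 / 5 : ℝ) ^ 3 ≤ Real.log d := by
    have hmono : Real.log 2 ≤ Real.log d := Real.log_le_log (by norm_num) (by exact_mod_cast hd)
    linarith [Real.log_two_gt_d9]
  calc (4 / 5 : ℝ) = ((4 / 5 : ℝ) ^ 3) ^ (1 / 3 : ℝ) := by
        rw [← Real.rpow_natCast_mul (by norm_num)]
        norm_num
    _ ≤ Real.log d ^ (1 / 3 : ℝ) := by gcongr

theorem exists_separable_approximation_of_two_le (hd : 2 ≤ d) {ρ : Op n d} (hρ : IsDensity ρ)
    (hGsymm : G.IsSymm) (hG : ∀ i j, 0 ≤ G i j) (hGsum : ∑ i, ∑ j, G i j = 1) :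
    ∃ σ : Op n d, GloballySeparable σ ∧
      ∑ i, ∑ j, G i j * traceNorm (marginal {i, j} ρ - marginal {i, j} σ) ≤
        cubeRootError d G := by
  have : NeZero d := ⟨by lia⟩
  set T := (walkMatrix G * walkMatrix G).trace
  set s := ∑ j, stationary G j ^ 2
  have hT : 0 < T := zero_lt_one.trans_le (one_le_trace_walkMatrix_sq hGsymm hG hGsum)
  have hs : 0 < s := sum_stationary_sq_pos hGsum
  have : (0 : ℝ) < d := by exact_mod_cast NeZero.pos d
  set t := (d : ℝ) ^ 4 * T * s
  have ht : 0 < t := by positivity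
  -- The two error terms `4 √(t μ)` and `4 / μ` balance at `μ = t ^ (-1 / 3)`.
  set u := t ^ (1 / 3 : ℝ)
  have hu : 0 < u := Real.rpow_pos_of_pos ht _
  obtain ⟨C, hC⟩ := (probeMeasurement d).exists_sum_traceNorm_rounded_le probeMeasurement_isFrame
    hρ hGsymm hG hGsum (inv_pos.2 hu)
  have hsep := (probeMeasurement d).rounded_globallySeparable hρ C
  refine ⟨_, hsep, le_min (sum_mul_traceNorm_sub_le_two hG hGsum hρ hsep.isDensity) ?_⟩
  calc _ ≤ d * 2 * (2 * d) * √(T * s * u⁻¹) + 4 / u⁻¹ := hC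
    _ = 4 * √(t * u⁻¹) + 4 * u := by
        rw [show t * u⁻¹ = ((d : ℝ) ^ 2) ^ 2 * (T * s * u⁻¹) by ring,
          Real.sqrt_mul (sq_nonneg _), Real.sqrt_sq (sq_nonneg _), div_inv_eq_mul]
        ring
    _ = 10 * (4 / 5 * u) := by
        rw [sqrt_mul_inv_cubeRoot ht]
        ring
    _ ≤ 10 * (Real.log d ^ (1 / 3 : ℝ) * u) := by
        gcongr
        exact four_fifths_le_log_rpow hd
    _ = 10 * (d ^ 4 * Real.log d * T * s) ^ (1 / 3 : ℝ) := by
        rw [← Real.mul_rpow (Real.log_natCast_nonneg d) ht.le]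
        congr 2
        ring

theorem exists_separable_approximation (hd : 1 ≤ d) {ρ : Op n d} (hρ : IsDensity ρ)
    (hGsymm : G.IsSymm) (hG : ∀ i j, 0 ≤ G i j) (hGsum : ∑ i, ∑ j, G i j = 1) :
    ∃ σ : Op n d, GloballySeparable σ ∧
      ∑ i, ∑ j, G i j * traceNorm (marginal {i, j} ρ - marginal {i, j} σ) ≤
        cubeRootError d G := by
  obtain rfl | hd := hd.eq_or_lt
  · have hsep : GloballySeparable ((probeMeasurement 1).rounded ρ ∅) :=
      (probeMeasurement 1).rounded_globallySeparable hρ ∅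
    refine ⟨ρ, hρ.eq_of_subsingleton hsep.isDensity ▸ hsep, ?_⟩
    simpa using cubeRootError_nonneg 1 hG
  · exact exists_separable_approximation_of_two_le hd hρ hGsymm hG hGsum

end Approximation

section GroundState

variable {ι : Type*} [Fintype ι]

theorem star_dotProduct_self_eq_one_iff {v : EuclideanSpace ℂ ι} :
    star v.ofLp ⬝ᵥ v.ofLp = 1 ↔ ‖v‖ = 1 := by
  rw [dotProduct_comm, ← EuclideanSpace.inner_eq_star_dotProduct, inner_self_eq_norm_sq_to_K,
    ← RCLike.ofReal_pow, ← RCLike.ofReal_one, RCLike.ofReal_inj,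
    pow_eq_one_iff_of_nonneg (norm_nonneg v) two_ne_zero]

theorem exists_density_energy_le_groundEnergy [Nonempty ι] (H : Matrix ι ι ℂ) :
    ∃ ρ : Matrix ι ι ℂ, IsDensity ρ ∧ (H * ρ).trace.re ≤ groundEnergy H := by
  classical
  let energy (v : EuclideanSpace ℂ ι) : ℝ := (star v.ofLp ⬝ᵥ H *ᵥ v.ofLp).re
  have henergy : Continuous energy := by fun_prop
  obtain ⟨v, hv, hmin⟩ := (isCompact_sphere (0 : EuclideanSpace ℂ ι) 1).exists_isMinOn
    ⟨EuclideanSpace.single (Classical.arbitrary ι) 1, by simp⟩ henergy.continuousOn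
  have hv1 := star_dotProduct_self_eq_one_iff.2 (mem_sphere_zero_iff_norm.1 hv)
  refine ⟨proj v.ofLp, isDensity_proj hv1, ?_⟩
  rw [trace_mul_proj]
  refine le_csInf ⟨_, v.ofLp, hv1, rfl⟩ ?_
  rintro e ⟨ψ, hψ, rfl⟩
  exact hmin (a := WithLp.toLp 2 ψ)
    (mem_sphere_zero_iff_norm.2 (star_dotProduct_self_eq_one_iff.1 hψ))

end GroundState

section Rounding

variable {n d : ℕ}

theorem exists_le_of_weighted_sum_le {X : Type*} [Fintype X] {w f : X → ℝ} {e : ℝ}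
    (hw : ∀ x, 0 ≤ w x) (hw1 : ∑ x, w x = 1) (h : ∑ x, w x * f x ≤ e) : ∃ x, f x ≤ e := by
  by_contra! hf
  obtain ⟨x, hx⟩ : ∃ x, 0 < w x := by
    by_contra! hw0
    linarith [sum_nonpos fun x (_ : x ∈ univ) => hw0 x]
  refine h.not_gt ?_
  calc e = ∑ x, w x * e := by rw [← sum_mul, hw1, one_mul]
    _ < ∑ x, w x * f x := sum_lt_sum (fun x _ => mul_le_mul_of_nonneg_left (hf x).le (hw x))
        ⟨x, mem_univ x, mul_lt_mul_of_pos_left (hf x) hx⟩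

theorem re_trace_mul_sum_smul {ι X : Type*} [Fintype ι] [Fintype X] (H : Matrix ι ι ℂ)
    (c : X → ℝ) (A : X → Matrix ι ι ℂ) :
    (H * ∑ x, (c x : ℂ) • A x).trace.re = ∑ x, c x * (H * A x).trace.re := by
  simp only [Matrix.mul_sum, Matrix.mul_smul, trace_sum, trace_smul, smul_eq_mul, Complex.re_sum,
    Complex.re_ofReal_mul]

theorem IsDensity.sum_eigenvalues {ι : Type*} [Fintype ι] [DecidableEq ι] {ρ : Matrix ι ι ℂ}
    (hρ : IsDensity ρ) : ∑ i, hρ.1.isHermitian.eigenvalues i = 1 :=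
  Complex.ofReal_injective (by
    simpa using hρ.1.isHermitian.trace_eq_sum_eigenvalues.symm.trans hρ.2)

theorem tensorOp_sum_smul {κ : Type*} [Fintype κ] (c : Fin n → κ → ℂ)
    (B : Fin n → κ → Matrix (Fin d) (Fin d) ℂ) :
    tensorOp (fun k => ∑ a, c k a • B k a) =
      ∑ f : Fin n → κ, (∏ k, c k (f k)) • tensorOp fun k => B k (f k) := by
  ext x y
  simp only [tensorOp, of_apply, Matrix.sum_apply, Matrix.smul_apply, smul_eq_mul,
    prod_univ_sum, Fintype.piFinset_univ, prod_mul_distrib]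

theorem tensorOp_eq_sum_eigenvalues_smul_proj {s : Fin n → Matrix (Fin d) (Fin d) ℂ}
    (hs : ∀ k, (s k).IsHermitian) :
    tensorOp s = ∑ f : Fin n → Fin d, ((∏ k, (hs k).eigenvalues (f k) : ℝ) : ℂ) •
      proj (tensorVec fun k => (hs k).eigenvectorBasis (f k)) := by
  conv_lhs => rw [funext fun k => eq_sum_eigenvalues_smul_proj (hs k), tensorOp_sum_smul]
  simp only [tensorOp_proj, Complex.ofReal_prod]

theorem exists_product_vector_le_of_tensorOp (H : Op n d) {s : Fin n → Matrix (Fin d) (Fin d) ℂ}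
    (hs : ∀ k, IsDensity (s k)) :
    ∃ φ : Fin n → EuclideanSpace ℂ (Fin d), (∀ k, ‖φ k‖ = 1) ∧
      (H * proj (tensorVec φ)).trace.re ≤ (H * tensorOp s).trace.re := by
  have hherm := fun k => (hs k).1.isHermitian
  have hsum : ∑ f : Fin n → Fin d, ∏ k, (hherm k).eigenvalues (f k) = 1 := by
    rw [← Fintype.piFinset_univ, ← prod_univ_sum]
    exact prod_eq_one fun k _ => (hs k).sum_eigenvalues
  have havg := re_trace_mul_sum_smul H (fun f : Fin n → Fin d => ∏ k, (hherm k).eigenvalues (f k))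
    fun f => proj (tensorVec fun k => (hherm k).eigenvectorBasis (f k))
  rw [← tensorOp_eq_sum_eigenvalues_smul_proj hherm] at havg
  obtain ⟨f, hf⟩ := exists_le_of_weighted_sum_le
    (fun f => prod_nonneg fun k _ => (hs k).1.eigenvalues_nonneg (f k)) hsum havg.ge
  exact ⟨fun k => (hherm k).eigenvectorBasis (f k),
    fun k => (hherm k).eigenvectorBasis.orthonormal.1 (f k), hf⟩

theorem GloballySeparable.exists_product_vector_le (H : Op n d) {σ : Op n d}
    (hσ : GloballySeparable σ) :
    ∃ φ : Fin n → EuclideanSpace ℂ (Fin d), (∀ k, ‖φ k‖ = 1) ∧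
      (H * proj (tensorVec φ)).trace.re ≤ (H * σ).trace.re := by
  obtain ⟨m, p, s, hp, hp1, hs, rfl⟩ := hσ
  obtain ⟨z, hz⟩ := exists_le_of_weighted_sum_le hp hp1
    (re_trace_mul_sum_smul H p fun z => tensorOp (s z)).ge
  obtain ⟨φ, hφ, hle⟩ := exists_product_vector_le_of_tensorOp H (hs z)
  exact ⟨φ, hφ, hle.trans hz⟩

end Rounding

section Locality

variable {n d : ℕ} [NeZero d]

/-- The vector `v ⊗ |0…0⟩` on all `n` sites, for a vector `v` on the sites in `S`. -/
def padVec (S : Finset (Fin n)) (v : EuclideanSpace ℂ (Config d S)) :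
    EuclideanSpace ℂ (Fin n → Fin d) :=
  WithLp.toLp 2 fun x => if ∀ k : {k // k ∉ S}, x k = 0 then v fun k => x k else 0

theorem padVec_glue (S : Finset (Fin n)) (v : EuclideanSpace ℂ (Config d S)) (u : Config d S)
    (z : {k : Fin n // k ∉ S} → Fin d) : padVec S v (glue S u z) = if z = 0 then v u else 0 := by
  have hin : (fun k : {k // k ∈ S} => glue S u z k) = u := by
    funext ⟨k, hk⟩
    simp [glue, hk]
  have hout : (∀ k : {k // k ∉ S}, glue S u z k = 0) ↔ z = 0 := by
    simp +contextual [glue, funext_iff]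
  simp only [padVec, hin, hout]

theorem norm_padVec (S : Finset (Fin n)) (v : EuclideanSpace ℂ (Config d S)) :
    ‖padVec S v‖ = ‖v‖ := by
  rw [EuclideanSpace.norm_eq, EuclideanSpace.norm_eq, sum_eq_sum_glue S]
  simp [padVec_glue, apply_ite norm, ite_pow]

theorem marginal_proj_padVec (S : Finset (Fin n)) (v : EuclideanSpace ℂ (Config d S)) :
    marginal S (proj (padVec S v).ofLp) = proj v.ofLp := by
  ext a b
  simp [marginal, proj, vecMulVec_apply, padVec_glue]

theorem abs_re_dotProduct_mulVec_le_opNorm_extend (S : Finset (Fin n))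
    (h : Matrix (Config d S) (Config d S) ℂ) {v : EuclideanSpace ℂ (Config d S)} (hv : ‖v‖ = 1) :
    |(star v.ofLp ⬝ᵥ h *ᵥ v.ofLp).re| ≤ opNorm (extend S h) := by
  have henergy : star v.ofLp ⬝ᵥ h *ᵥ v.ofLp =
      star (padVec S v).ofLp ⬝ᵥ extend S h *ᵥ (padVec S v).ofLp := by
    rw [← trace_mul_proj, ← trace_mul_proj, trace_mul_comm, trace_mul_comm (extend S h),
      trace_mul_extend, marginal_proj_padVec]
  rw [henergy]
  exact abs_re_dotProduct_mulVec_le_opNorm _ ((norm_padVec S v).trans hv)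

theorem ActsOnlyOn.abs_re_trace_mul_sub_le {S : Finset (Fin n)} {M : Op n d}
    (hM : ActsOnlyOn S M) {ρ σ : Op n d} (hρ : ρ.IsHermitian) (hσ : σ.IsHermitian) :
    |(M * ρ).trace.re - (M * σ).trace.re| ≤
      opNorm M * traceNorm (marginal S ρ - marginal S σ) := by
  obtain ⟨h, rfl⟩ := hM
  have htrace : (extend S h * ρ).trace.re - (extend S h * σ).trace.re =
      (h * (marginal S ρ - marginal S σ)).trace.re := by
    rw [mul_sub, trace_sub, Complex.sub_re, trace_mul_comm, trace_mul_extend,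
      trace_mul_comm (extend S h), trace_mul_extend, trace_mul_comm h, trace_mul_comm h]
  rw [htrace, ← marginal_sub]
  exact abs_re_trace_mul_le (marginal_isHermitian S (hρ.sub hσ))
    fun v hv => abs_re_dotProduct_mulVec_le_opNorm_extend S h hv

theorem re_trace_sum_mul_sub_le {G : Matrix (Fin n) (Fin n) ℝ} (hG : ∀ i j, 0 ≤ G i j)
    {Hterm : Fin n → Fin n → Op n d} (hnorm : ∀ i j, opNorm (Hterm i j) ≤ 1)
    (hloc : ∀ i j, ActsOnlyOn {i, j} (Hterm i j)) {ρ σ : Op n d} (hρ : ρ.IsHermitian)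
    (hσ : σ.IsHermitian) :
    ((∑ i, ∑ j, (G i j : ℂ) • Hterm i j) * σ).trace.re -
        ((∑ i, ∑ j, (G i j : ℂ) • Hterm i j) * ρ).trace.re ≤
      ∑ i, ∑ j, G i j * traceNorm (marginal {i, j} ρ - marginal {i, j} σ) := by
  have hexpand (τ : Op n d) : ((∑ i, ∑ j, (G i j : ℂ) • Hterm i j) * τ).trace.re =
      ∑ i, ∑ j, G i j * (Hterm i j * τ).trace.re := by
    simp only [sum_mul, trace_sum, Complex.re_sum, Matrix.smul_mul, trace_smul, smul_eq_mul,
      Complex.re_ofReal_mul]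
  simp only [hexpand, ← sum_sub_distrib, ← mul_sub]
  refine sum_le_sum fun i _ => sum_le_sum fun j _ => mul_le_mul_of_nonneg_left ?_ (hG i j)
  calc (Hterm i j * σ).trace.re - (Hterm i j * ρ).trace.re
      ≤ |(Hterm i j * ρ).trace.re - (Hterm i j * σ).trace.re| := by
        rw [abs_sub_comm]
        exact le_abs_self _
    _ ≤ opNorm (Hterm i j) * traceNorm (marginal {i, j} ρ - marginal {i, j} σ) :=
        (hloc i j).abs_re_trace_mul_sub_le hρ hσ
    _ ≤ traceNorm (marginal {i, j} ρ - marginal {i, j} σ) :=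
        mul_le_of_le_one_left (traceNorm_nonneg _) (hnorm i j)

end Locality

end ProductApprox

end

theorem mainTheorem3_general (n d : ℕ) (hd : 1 ≤ d) (G : Matrix (Fin n) (Fin n) ℝ)
    (hGsymm : G.IsSymm) (hGnonneg : ∀ i j, 0 ≤ G i j) (hGsum : ∑ i, ∑ j, G i j = 1) :
    (∀ ρ : ProductApprox.Op n d, ProductApprox.IsDensity ρ →
      ∃ σ : ProductApprox.Op n d, ProductApprox.GloballySeparable σ ∧
        ∑ i, ∑ j, G i j * ProductApprox.traceNorm
          (ProductApprox.marginal {i, j} ρ - ProductApprox.marginal {i, j} σ)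
            ≤ ProductApprox.cubeRootError d G) ∧
    (∀ Hterm : Fin n → Fin n → ProductApprox.Op n d,
      (∀ i j, ProductApprox.opNorm (Hterm i j) ≤ 1) →
      (∀ i j, ProductApprox.ActsOnlyOn {i, j} (Hterm i j)) →
      ∀ H : ProductApprox.Op n d, H = ∑ i, ∑ j, (G i j : ℂ) • Hterm i j →
        ∃ φ : Fin n → EuclideanSpace ℂ (Fin d), (∀ k, ‖φ k‖ = 1) ∧
          (H * ProductApprox.proj (ProductApprox.tensorVec φ)).trace.re
            ≤ ProductApprox.groundEnergy H + ProductApprox.cubeRootError d G) := by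
  have happrox (ρ : ProductApprox.Op n d) (hρ : ProductApprox.IsDensity ρ) :=
    ProductApprox.exists_separable_approximation hd hρ hGsymm hGnonneg hGsum
  refine ⟨happrox, fun Hterm hnorm hloc H hH => ?_⟩
  have : NeZero d := ⟨by lia⟩
  obtain ⟨ρ, hρ, hground⟩ := ProductApprox.exists_density_energy_le_groundEnergy H
  obtain ⟨σ, hσ, hclose⟩ := happrox ρ hρ
  obtain ⟨φ, hφ, hproduct⟩ := hσ.exists_product_vector_le H
  have henergy := hH ▸ ProductApprox.re_trace_sum_mul_sub_le hGnonneg hnorm hloc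
    hρ.1.isHermitian hσ.isDensity.1.isHermitian
  exact ⟨φ, hφ, by linarith⟩

theorem mainTheorem3 (n d : ℕ) (hd : 1 ≤ d) (G : Matrix (Fin n) (Fin n) ℝ)
    (hGsymm : G.IsSymm) (hGnonneg : ∀ i j, 0 ≤ G i j) (hGsum : ∑ i, ∑ j, G i j = 1) :
    (∀ ρ : ProductApprox.Op n d, ProductApprox.IsDensity ρ →
      ∃ σ : ProductApprox.Op n d, ProductApprox.GloballySeparable σ ∧
        ∑ i, ∑ j, G i j * ProductApprox.traceNorm
          (ProductApprox.marginal {i, j} ρ - ProductApprox.marginal {i, j} σ)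
            ≤ ProductApprox.errorBound d G) ∧
    (∀ Hterm : Fin n → Fin n → ProductApprox.Op n d,
      (∀ i j, (Hterm i j).IsHermitian) →
      (∀ i j, ProductApprox.opNorm (Hterm i j) ≤ 1) →
      (∀ i j, ProductApprox.ActsOnlyOn {i, j} (Hterm i j)) →
      ∀ H : ProductApprox.Op n d, H = ∑ i, ∑ j, (G i j : ℂ) • Hterm i j →
        ∃ φ : Fin n → EuclideanSpace ℂ (Fin d), (∀ k, ‖φ k‖ = 1) ∧
          (H * ProductApprox.proj (ProductApprox.tensorVec φ)).trace.re
            ≤ ProductApprox.groundEnergy H + ProductApprox.errorBound d G) := by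
  have hle := ProductApprox.cubeRootError_le_errorBound d hGnonneg
  obtain ⟨hsep, hprod⟩ := mainTheorem3_general n d hd G hGsymm hGnonneg hGsum
  exact ⟨fun ρ hρ => (hsep ρ hρ).imp fun σ hσ => ⟨hσ.1, hσ.2.trans hle⟩,
    fun Hterm _ hnorm hloc H hH => (hprod Hterm hnorm hloc H hH).imp fun φ hφ =>
      ⟨hφ.1, hφ.2.trans (by gcongr)⟩⟩
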